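/- **Setting.** Let $\Omega\subset\mathbb R^2$ be a bounded domain with convex polygonal boundary, and let $\Omega_1,\Omega_2\subset\Omega$ be disjoint open sets such that $\Gamma=\Omega\setminus(\Omega_1\cup\Omega_2)$ is an interface of class $C^2$ separating them: every point of $\overline\Gamma$ has a neighbourhood $U$ and a $C^2$ function $\varphi$ on $U$ whose gradient does not vanish at that point, such that in $U\cap\Omega$ the sets $\Omega_1$, $\Gamma$, $\Omega_2$ are given by $\varphi>0$, $\varphi=0$, $\varphi<0$, respectively. ($\Gamma$ may be a closed curve inside $\Omega$ or may reach $\partial\Omega$.) Let $\alpha_1,\alpha_2>0$ and let $\alpha=\alpha_i$ on $\Omega_i$. Let $\mathcal T_h$ be a conforming triangulation of $\overline\Omega$, $h_T=\operatorname{diam}T$, $h=\max_T h_T$, and let $\rho_T$ be the diameter of the largest ball contained in $T$. Fix $\sigma,\tau$ and assume: * (A1) $h_T/\rho_T\le\sigma$ for all $T\in\mathcal T_h$, and the mesh is quasi-uniform: $h\le\tau h_T$ for all $T\in\mathcal T_h$; * (A2) for each $T\in\mathcal T_h$ whose interior meets $\Gamma$, the set $\overline\Gamma\cap\partial T$ consists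 of exactly two points $p\ne q$, which lie on different edges of $T$; * (A3) for each such $T$, in Cartesian coordinates $(\xi,\eta)$ in which the segment $[p,q]$ is $\{0\le\xi\le|p-q|,\ \eta=0\}$, one has $\overline\Gamma\cap T=\{(\xi,\psi(\xi)):0\le\xi\le|p-q|\}$ for some function $\psi$. Let $V_h^P$ be the space of continuous functions on $\overline\Omega$ that are affine on each $T\in\mathcal T_h$, and $\varphi_i\in V_h^P$ the nodal basis function of the mesh point $P_i$. Let $V_h^\Gamma$ be the span of the functions $\widetilde\varphi_i$ with $\operatorname{supp}\varphi_i\cap\Gamma\ne\emptyset$, where $\widetilde\varphi_i=0$ in $\Omega_m$ and $\widetilde\varphi_i=\varphi_i$ in $\Omega\setminus\Omega_m$ if $P_i\in\overline{\Omega_m}$ (if $P_i\in\overline\Gamma$, both choices of $m$ are used). Let $$V_h=\{v_h\in V_h^P+V_h^\Gamma:\ v_h|_{\partial\Omega}=0\},$$ where the boundary condition means that $v_h(x)\to0$ as $x\in\Omega_1\cup\Omega_2$ tends to any point of $\partial\Omega$. For $T\in\mathcal T_h$ let $T_m=T\cap\Omega_m$ and $k_m=|T_m|/|T|$. Let $\mathbf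 n$ be the unit normal field on $\Gamma$ pointing into $\Omega_1$, $v_m$ the trace on $\Gamma$ of $v|_{\Omega_m}$, $[v]=v_1-v_2$, and, on $\Gamma\cap T$, $\{\alpha\nabla_{\mathbf n}v\}=k_1\alpha_1\nabla_{\mathbf n}v_1+k_2\alpha_2\nabla_{\mathbf n}v_2$, where $\nabla v_m$ is the (constant) gradient of $v$ on $T_m$. For $\widetilde C>0$ put $\lambda=\widetilde C h^{-1}\max\{\alpha_1,\alpha_2\}$ and $$a_h(u,v)=\sum_{m=1}^2\int_{\Omega_m}\alpha_m\nabla u\cdot\nabla v\,dx-\int_\Gamma\{\alpha\nabla_{\mathbf n}u\}[v]\,ds-\int_\Gamma\{\alpha\nabla_{\mathbf n}v\}[u]\,ds+\lambda\int_\Gamma[u][v]\,ds .$$ **Theorem (discrete Poincaré inequality).** There are constants $C_0>0$ and $c>0$, depending only on $\Omega$, $\Omega_1$, $\Omega_2$, $\alpha_1$, $\alpha_2$, $\sigma$ and $\tau$ (in particular independent of the mesh, of $h$, and of how $\Gamma$ cuts the mesh), such that for every $\widetilde C\ge C_0$, every triangulation $\mathcal T_h$ satisfying (A1)–(A3) and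 every $v_h\in V_h$, $$a_h(v_h,v_h)\ \ge\ c\,\|v_h\|_{0,\Omega_1\cup\Omega_2}^2=c\left(\|v_h\|^2_{L^2(\Omega_1)}+\|v_h\|^2_{L^2(\Omega_2)}\right).$$ The same holds, with the same constants, if $\mathbf n$ is replaced by $-\mathbf n$ (the unit normal pointing into $\Omega_2$). -/

import Mathlib

open MeasureTheory Filter Topology Set
open scoped Gradient RealInnerProductSpace

noncomputable section

namespace NitscheXFEM

/-- The Euclidean plane. -/
abbrev Plane : Type := EuclideanSpace ℝ (Fin 2)

/-- A bounded domain `Ω` with convex polygonal boundary, divided by an interface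
`Γ = Ω \ (Ω₁ ∪ Ω₂)` of class `C²` into two disjoint open sets `Ω₁ = sub 0` and `Ω₂ = sub 1`.
Near each point of the closure of `Γ`, and inside `Ω`, the set `Γ` is the zero set of a `C²`
function with nonvanishing gradient, and `Ω₁`, `Ω₂` are its two sides.  The interface may be a
closed curve inside `Ω`, and it may also reach `∂Ω`. -/
structure InterfaceDomain where
  Ω : Set Plane
  sub : Fin 2 → Set Plane
  polygon : ∃ V : Finset Plane, Ω = interior (convexHull ℝ (V : Set Plane))
  nonempty : Ω.Nonempty
  sub_open : ∀ m, IsOpen (sub m)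
  sub_subset : ∀ m, sub m ⊆ Ω
  sub_disjoint : Disjoint (sub 0) (sub 1)
  regular : ∀ x ∈ closure (Ω \ (sub 0 ∪ sub 1)), ∃ (U : Set Plane) (φ : Plane → ℝ),
    IsOpen U ∧ x ∈ U ∧ ContDiffOn ℝ 2 φ U ∧ ∇ φ x ≠ 0 ∧
      ∀ y ∈ U ∩ Ω, (y ∈ sub 0 ↔ 0 < φ y) ∧ (y ∈ sub 1 ↔ φ y < 0)

namespace InterfaceDomain

/-- The interface `Γ`. -/
def Γ (D : InterfaceDomain) : Set Plane := D.Ω \ (D.sub 0 ∪ D.sub 1)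

/-- `n` is the unit normal field on `Γ` that points into the subdomain `Ω_m`: at each point of
`Γ` it is the normalized gradient of a local `C²` equation of `Γ` that is positive exactly on the
`Ω_m` side. -/
def IsUnitNormalInto (D : InterfaceDomain) (m : Fin 2) (n : Plane → Plane) : Prop :=
  ∀ x ∈ D.Γ, ∃ (U : Set Plane) (φ : Plane → ℝ),
    IsOpen U ∧ x ∈ U ∧ ContDiffOn ℝ 2 φ U ∧ ∇ φ x ≠ 0 ∧
      (∀ y ∈ U ∩ D.Ω, (y ∈ D.sub m ↔ 0 < φ y) ∧ (y ∈ D.Γ ↔ φ y = 0)) ∧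
      n x = ‖∇ φ x‖⁻¹ • ∇ φ x

/-- `‖v‖²_{0,Ω₁∪Ω₂} = ‖v‖²_{L²(Ω₁)} + ‖v‖²_{L²(Ω₂)}`. -/
def normSq (D : InterfaceDomain) (v : Plane → ℝ) : ℝ :=
  ∑ m : Fin 2, ∫ x in D.sub m, v x ^ 2

/-- The trace `v_m` at a point of `Γ` of the restriction of `v` to `Ω_m`. -/
def trace (D : InterfaceDomain) (m : Fin 2) (v : Plane → ℝ) (x : Plane) : ℝ :=
  limUnder (𝓝[D.sub m] x) v

/-- The jump `[v] = v₁ - v₂` on `Γ`. -/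
def jump (D : InterfaceDomain) (v : Plane → ℝ) (x : Plane) : ℝ :=
  D.trace 0 v x - D.trace 1 v x

end InterfaceDomain

/-- A conforming triangulation of the closure of `Ω`: a finite geometric simplicial complex with
underlying space `closure Ω`. -/
structure Triangulation (Ω : Set Plane) where
  complex : Geometry.SimplicialComplex ℝ Plane
  finite : complex.faces.Finite
  space_eq : complex.space = closure Ω

/-- The closed triangle (or edge) spanned by a finite set of vertices. -/
def hull (s : Finset Plane) : Set Plane := convexHull ℝ (s : Set Plane)

/-- The diameter of the largest ball contained in the triangle `T`. -/
def inDiam (T : Finset Plane) : ℝ :=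
  sSup {d : ℝ | 0 ≤ d ∧ ∃ x, Metric.closedBall x (d / 2) ⊆ hull T}

/-- The size `h_T` of a triangle. -/
def hT (T : Finset Plane) : ℝ := Metric.diam (hull T)

namespace Triangulation

variable {Ω : Set Plane}

/-- The elements `T` of the triangulation, each given by its three vertices. -/
def triangles (𝒯 : Triangulation Ω) : Finset (Finset Plane) :=
  {T ∈ 𝒯.finite.toFinset | T.card = 3}

/-- The mesh size `h`, the maximum of the `h_T`. -/
def meshSize (𝒯 : Triangulation Ω) : ℝ := sSup (hT '' (𝒯.triangles : Set (Finset Plane)))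

/-- Nondegeneracy: `h_T / ρ_T ≤ σ` for all elements `T`. -/
def ShapeRegular (𝒯 : Triangulation Ω) (σ : ℝ) : Prop :=
  ∀ T ∈ 𝒯.triangles, hT T / inDiam T ≤ σ

/-- Quasi-uniformity: `h ≤ τ h_T` for all elements `T`. -/
def QuasiUniform (𝒯 : Triangulation Ω) (τ : ℝ) : Prop :=
  ∀ T ∈ 𝒯.triangles, 𝒯.meshSize ≤ τ * hT T

/-- The standard linear finite element space `V_h^P`: continuous functions on `closure Ω` that
are affine on each element (extended by zero outside `closure Ω`). -/
def linearSpace (𝒯 : Triangulation Ω) : Submodule ℝ (Plane → ℝ) where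
  carrier := {v | ContinuousOn v (closure Ω) ∧ (∀ x ∉ closure Ω, v x = 0) ∧
    ∀ T ∈ 𝒯.triangles, ∃ A : Plane →ᵃ[ℝ] ℝ, EqOn v A (hull T)}
  zero_mem' := ⟨continuousOn_const, fun _ _ => rfl, fun _ _ => ⟨0, fun _ _ => rfl⟩⟩
  add_mem' := by
    rintro v w ⟨hv, hv0, hvA⟩ ⟨hw, hw0, hwA⟩
    refine ⟨hv.add hw, fun x hx => by simp [hv0 x hx, hw0 x hx], fun T hT => ?_⟩
    obtain ⟨A, hA⟩ := hvA T hT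
    obtain ⟨B, hB⟩ := hwA T hT
    exact ⟨A + B, fun x hx => by simp [hA hx, hB hx]⟩
  smul_mem' := by
    rintro a v ⟨hv, hv0, hvA⟩
    refine ⟨hv.const_smul a, fun x hx => by simp [hv0 x hx], fun T hT => ?_⟩
    obtain ⟨A, hA⟩ := hvA T hT
    exact ⟨a • A, fun x hx => by simp [hA hx]⟩

/-- `φ` is the nodal basis function of the mesh point `P`. -/
def IsNodal (𝒯 : Triangulation Ω) (P : Plane) (φ : Plane → ℝ) : Prop :=
  φ ∈ 𝒯.linearSpace ∧ φ P = 1 ∧ ∀ Q ∈ 𝒯.complex.vertices, Q ≠ P → φ Q = 0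

end Triangulation

variable (D : InterfaceDomain) (𝒯 : Triangulation D.Ω)

/-- The interior of the element `T` meets the interface. -/
def IsCut (T : Finset Plane) : Prop := (interior (hull T) ∩ D.Γ).Nonempty

/-- The boundary of the element `T` meets the interface in exactly the two points `p ≠ q`. -/
def MeetsBoundaryAt (T : Finset Plane) (p q : Plane) : Prop :=
  p ≠ q ∧ closure D.Γ ∩ frontier (hull T) = {p, q}

/-- The interface intersects (the boundary of) each element that it cuts in exactly two different
points, which lie on different edges. -/
def TwoPointCuts : Prop :=
  ∀ T ∈ 𝒯.triangles, IsCut D T → ∃ p q, MeetsBoundaryAt D T p q ∧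
    ∃ e f : Finset Plane, e ⊆ T ∧ f ⊆ T ∧ e.card = 2 ∧ f.card = 2 ∧ e ≠ f ∧
      p ∈ hull e ∧ q ∈ hull f

/-- In each cut element `Γ_T` is the graph of a function `ψ` over the segment `Γ_{T,h} = [p, q]`
joining the two intersection points, in a Cartesian coordinate system `(ξ, η)` with origin `p` and
orthonormal axes `t`, `ν`, the first one along the segment. -/
def GraphCuts : Prop :=
  ∀ T ∈ 𝒯.triangles, IsCut D T → ∀ p q, MeetsBoundaryAt D T p q →
    ∃ (t ν : Plane) (ψ : ℝ → ℝ), ‖t‖ = 1 ∧ ‖ν‖ = 1 ∧ ⟪t, ν⟫ = 0 ∧ q = p + dist p q • t ∧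
      closure D.Γ ∩ hull T = (fun ξ : ℝ => p + ξ • t + ψ ξ • ν) '' Icc 0 (dist p q)

/-- The cut finite element space `V_h^Γ`, spanned by the cut basis functions `φ̃_P`, equal to `0` in
`Ω_m` and to the nodal function `φ_P` in `Ω \ Ω_m`, where `Ω_m` is the subdomain of the mesh point
`P`.  Closures make this meaningful for `P ∈ ∂Ω`; for `P ∈ Γ` both choices of `m` are used. -/
def cutSpace : Submodule ℝ (Plane → ℝ) :=
  Submodule.span ℝ {w | ∃ P ∈ 𝒯.complex.vertices, ∃ φ, 𝒯.IsNodal P φ ∧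
    (tsupport φ ∩ D.Γ).Nonempty ∧ ∃ m, P ∈ closure (D.sub m) ∧
      w = indicator (D.Ω \ D.sub m) φ}

/-- The extended finite element space
`V_h = {v ∈ V_h^P ⊕ V_h^Γ : v = 0 on ∂Ω}`, the boundary condition being read from within
`Ω₁ ∪ Ω₂`. -/
def xfemSpace : Submodule ℝ (Plane → ℝ) where
  carrier := {v | v ∈ 𝒯.linearSpace ⊔ cutSpace D 𝒯 ∧
    ∀ x ∈ frontier D.Ω, Tendsto v (𝓝[D.sub 0 ∪ D.sub 1] x) (𝓝 0)}
  zero_mem' := ⟨Submodule.zero_mem _, fun _ _ => tendsto_const_nhds⟩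
  add_mem' := by
    rintro v w ⟨hv, hv0⟩ ⟨hw, hw0⟩
    exact ⟨Submodule.add_mem _ hv hw, fun x hx => by
      simpa only [add_zero] using! (hv0 x hx).add (hw0 x hx)⟩
  smul_mem' := by
    rintro a v ⟨hv, hv0⟩
    exact ⟨Submodule.smul_mem _ a hv, fun x hx => by
      simpa only [smul_zero] using! (hv0 x hx).const_smul a⟩

/-- The weight `k_m = |T_m| / |T|` on the element `T`, with `T_m = T ∩ Ω_m`. -/
def weight (m : Fin 2) (T : Finset Plane) : ℝ :=
  volume.real (hull T ∩ D.sub m) / volume.real (hull T)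

/-- The gradient of `v` on `T_m = T ∩ Ω_m`.  Functions in `V_h` are affine on `T_m`, so this mean
value is their constant gradient there (it is `0` if `|T_m| = 0`, where `k_m = 0`). -/
def elementGrad (m : Fin 2) (T : Finset Plane) (v : Plane → ℝ) : Plane :=
  (volume.real (hull T ∩ D.sub m))⁻¹ • ∫ x in hull T ∩ D.sub m, ∇ v x

/-- The average `{α ∇_n v} = k₁ α₁ ∇_n v₁ + k₂ α₂ ∇_n v₂` on `Γ_T`, at a point with unit
normal `ν`. -/
def avgFlux (α : Fin 2 → ℝ) (T : Finset Plane) (v : Plane → ℝ) (ν : Plane) : ℝ :=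
  ∑ m : Fin 2, weight D m T * (α m * ⟪elementGrad D m T v, ν⟫)

/-- `({α ∇_n u}, [v])_Γ`, the sum over the elements `T` of the line integrals over
`Γ_T = Γ ∩ T` with respect to arc length (one-dimensional Hausdorff measure). -/
def fluxJump (α : Fin 2 → ℝ) (n : Plane → Plane) (u v : Plane → ℝ) : ℝ :=
  ∑ T ∈ 𝒯.triangles,
    ∫ x in D.Γ ∩ hull T, avgFlux D α T u (n x) * D.jump v x ∂(Measure.hausdorffMeasure 1)

/-- The Nitsche-XFEM bilinear form `a_h(u, v)`, with stabilization parameter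
`λ = C h⁻¹ max {α₁, α₂}`. -/
def nitscheForm (α : Fin 2 → ℝ) (C : ℝ) (n : Plane → Plane) (u v : Plane → ℝ) : ℝ :=
  (∑ m : Fin 2, ∫ x in D.sub m, α m * ⟪∇ u x, ∇ v x⟫)
    - fluxJump D 𝒯 α n u v - fluxJump D 𝒯 α n v u
    + C * 𝒯.meshSize⁻¹ * max (α 0) (α 1) *
      ∫ x in D.Γ, D.jump u x * D.jump v x ∂(Measure.hausdorffMeasure 1)

end NitscheXFEM

end

noncomputable section

namespace NitscheXFEM

/-! ### Length of the interface in small balls -/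

lemma hausdorffMeasure_inter_closedBall_le_of_dist_le {S : Set Plane} {t : Plane} (ht : ‖t‖ = 1)
    (hS : ∀ y ∈ S, ∀ z ∈ S, dist y z ≤ 2 * |⟪t, y - z⟫|) (x : Plane) (r : ℝ) :
    Measure.hausdorffMeasure 1 (S ∩ Metric.closedBall x r) ≤ ENNReal.ofReal (4 * r) := by
  set A := S ∩ Metric.closedBall x r with hA
  set p : Plane → ℝ := fun y => ⟪t, y⟫ with hp
  set f := Function.invFunOn p A with hf
  have hinj : InjOn p A := by
    intro y hy z hz hyz
    have := hS y hy.1 z hz.1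
    have h0 : ⟪t, y - z⟫ = 0 := by
      rw [inner_sub_right, sub_eq_zero]; exact hyz
    rw [h0] at this
    simpa using this
  have hleft : ∀ y ∈ A, f (p y) = y := fun y hy => hinj.leftInvOn_invFunOn hy
  have hlip : LipschitzOnWith 2 f (p '' A) := by
    refine LipschitzOnWith.of_dist_le_mul ?_
    rintro _ ⟨y, hy, rfl⟩ _ ⟨z, hz, rfl⟩
    rw [hleft y hy, hleft z hz, Real.dist_eq, ← inner_sub_right]
    exact hS y hy.1 z hz.1
  have himg : f '' (p '' A) = A := by
    rw [image_image]
    ext y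
    constructor
    · rintro ⟨z, hz, rfl⟩
      simpa [hleft z hz] using hz
    · exact fun hy => ⟨y, hy, hleft y hy⟩
  have hsub : p '' A ⊆ Icc (p x - r) (p x + r) := by
    rintro _ ⟨y, hy, rfl⟩
    have h1 : |p y - p x| ≤ r := by
      have := abs_real_inner_le_norm t (y - x)
      rw [ht, one_mul, inner_sub_right] at this
      exact this.trans (by simpa [dist_eq_norm] using hy.2)
    rw [abs_le] at h1
    constructor <;> linarith
  calc Measure.hausdorffMeasure 1 A = Measure.hausdorffMeasure 1 (f '' (p '' A)) := by rw [himg]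
    _ ≤ ((2 : NNReal) : ENNReal) ^ (1 : ℝ) * Measure.hausdorffMeasure 1 (p '' A) :=
      hlip.hausdorffMeasure_image_le zero_le_one
    _ ≤ 2 * volume (Icc (p x - r) (p x + r)) := by
      rw [ENNReal.rpow_one, hausdorffMeasure_real]
      gcongr
      rfl
    _ = ENNReal.ofReal (4 * r) := by
      rw [Real.volume_Icc, show (4 : ℝ) * r = 2 * (p x + r - (p x - r)) by ring,
        ENNReal.ofReal_mul zero_le_two]
      simp

/-- Rotation of a vector of the plane by a quarter turn. -/
def rot (v : Plane) : Plane := !₂[-v 1, v 0]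

lemma inner_plane (v w : Plane) : ⟪v, w⟫ = v 0 * w 0 + v 1 * w 1 := by
  simp [PiLp.inner_apply, Fin.sum_univ_two, mul_comm]

lemma norm_sq_plane (v : Plane) : ‖v‖ ^ 2 = v 0 ^ 2 + v 1 ^ 2 := by
  rw [← real_inner_self_eq_norm_sq, inner_plane]; ring

lemma norm_rot (v : Plane) : ‖rot v‖ = ‖v‖ := by
  have : ‖rot v‖ ^ 2 = ‖v‖ ^ 2 := by
    rw [norm_sq_plane, norm_sq_plane]; simp [rot]; ring
  exact (sq_eq_sq₀ (norm_nonneg _) (norm_nonneg _)).1 this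

lemma inner_sq_add_inner_rot_sq (v w : Plane) :
    ⟪v, w⟫ ^ 2 + ⟪rot v, w⟫ ^ 2 = ‖v‖ ^ 2 * ‖w‖ ^ 2 := by
  rw [norm_sq_plane, norm_sq_plane, inner_plane, inner_plane]; simp [rot]; ring

lemma hasStrictFDerivAt_of_contDiffOn {U : Set Plane} {φ : Plane → ℝ} {x : Plane} (hU : IsOpen U)
    (hx : x ∈ U) (hφ : ContDiffOn ℝ 2 φ U) :
    HasStrictFDerivAt φ (InnerProductSpace.toDual ℝ Plane (∇ φ x)) x := by
  have h := (hφ.contDiffAt (hU.mem_nhds hx)).hasStrictFDerivAt (by norm_num)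
  have h2 : fderiv ℝ φ x = InnerProductSpace.toDual ℝ Plane (∇ φ x) := by
    simp [gradient]
  rwa [h2] at h

lemma exists_nhds_dist_le_inner {U : Set Plane} {φ : Plane → ℝ} {x : Plane} (hU : IsOpen U)
    (hx : x ∈ U) (hφ : ContDiffOn ℝ 2 φ U) (h0 : ∇ φ x ≠ 0) :
    ∃ W ∈ 𝓝 x, ∃ t : Plane, ‖t‖ = 1 ∧ ∀ y ∈ W, ∀ z ∈ W, φ y = 0 → φ z = 0 →
      dist y z ≤ 2 * |⟪t, y - z⟫| := by
  have hd := hasStrictFDerivAt_of_contDiffOn hU hx hφ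
  set g := ∇ φ x with hg
  have hgpos : 0 < ‖g‖ := norm_pos_iff.2 h0
  have hlo := hd.isLittleO.def (half_pos hgpos)
  rw [nhds_prod_eq, Filter.Eventually, Filter.mem_prod_self_iff] at hlo
  obtain ⟨W, hW, hWs⟩ := hlo
  refine ⟨W, hW, ‖g‖⁻¹ • rot g, ?_, ?_⟩
  · rw [norm_smul, norm_rot, norm_inv, norm_norm, inv_mul_cancel₀ hgpos.ne']
  · intro y hy z hz hy0 hz0
    have h1 := hWs (mk_mem_prod hy hz)
    simp only [mem_ofPred_eq, hy0, hz0, sub_self, zero_sub,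
      InnerProductSpace.toDual_apply_apply, Real.norm_eq_abs, abs_neg] at h1
    have h2 := inner_sq_add_inner_rot_sq g (y - z)
    rw [inner_smul_left, abs_mul, dist_eq_norm]
    simp only [conj_trivial, abs_inv, abs_norm]
    have h3 : ⟪g, y - z⟫ ^ 2 ≤ (‖g‖ / 2 * ‖y - z‖) ^ 2 := by
      rw [← sq_abs]; gcongr
    have h4 : (‖g‖ * ‖y - z‖) ^ 2 ≤ (2 * |⟪rot g, y - z⟫|) ^ 2 := by
      rw [mul_pow 2, sq_abs]; nlinarith [sq_nonneg (‖g‖ * ‖y - z‖)]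
    have h5 := (sq_le_sq₀ (by positivity) (by positivity)).1 h4
    rw [← mul_assoc, mul_comm (2 : ℝ), mul_assoc, inv_mul_eq_div, le_div_iff₀ hgpos]
    linarith

namespace InterfaceDomain

variable (D : InterfaceDomain)

lemma Γ_subset : D.Γ ⊆ D.Ω := sdiff_subset

lemma isOpen_Ω : IsOpen D.Ω := by
  obtain ⟨V, hV⟩ := D.polygon
  rw [hV]; exact isOpen_interior

lemma convex_Ω : Convex ℝ D.Ω := by
  obtain ⟨V, hV⟩ := D.polygon
  rw [hV]; exact (convex_convexHull ℝ _).interior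

lemma isBounded_Ω : Bornology.IsBounded D.Ω := by
  obtain ⟨V, hV⟩ := D.polygon
  rw [hV]
  exact (isBounded_convexHull.2 V.finite_toSet.isBounded).subset interior_subset

lemma measurableSet_sub (m : Fin 2) : MeasurableSet (D.sub m) := (D.sub_open m).measurableSet

lemma measurableSet_Γ : MeasurableSet D.Γ :=
  D.isOpen_Ω.measurableSet.diff ((D.measurableSet_sub 0).union (D.measurableSet_sub 1))

lemma disjoint_sub {m m' : Fin 2} (h : m ≠ m') : Disjoint (D.sub m) (D.sub m') := by
  fin_cases m <;> fin_cases m' <;> first | exact absurd rfl h | exact D.sub_disjoint |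
    exact D.sub_disjoint.symm

lemma mem_Γ_or (x : Plane) (hx : x ∈ D.Ω) : x ∈ D.Γ ∨ ∃ m, x ∈ D.sub m := by
  by_cases h : x ∈ D.sub 0 ∪ D.sub 1
  · rcases h with h | h
    · exact Or.inr ⟨0, h⟩
    · exact Or.inr ⟨1, h⟩
  · exact Or.inl ⟨hx, h⟩

lemma exists_length_le : ∃ L > 0, ∀ (x : Plane) (r : ℝ), 0 ≤ r →
    Measure.hausdorffMeasure 1 (D.Γ ∩ Metric.closedBall x r) ≤ ENNReal.ofReal (L * r) := by
  have hloc : ∀ x ∈ closure D.Γ, ∃ W ∈ 𝓝 x, ∀ (y : Plane) (r : ℝ),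
      Measure.hausdorffMeasure 1 ((W ∩ D.Γ) ∩ Metric.closedBall y r) ≤ ENNReal.ofReal (4 * r) := by
    intro x hx
    obtain ⟨U, φ, hU, hxU, hφ, hg, hs⟩ := D.regular x hx
    obtain ⟨W, hW, t, ht, h⟩ := exists_nhds_dist_le_inner hU hxU hφ hg
    refine ⟨U ∩ W, inter_mem (hU.mem_nhds hxU) hW, fun y r =>
      hausdorffMeasure_inter_closedBall_le_of_dist_le ht ?_ y r⟩
    have hz : ∀ y ∈ U ∩ W ∩ D.Γ, φ y = 0 := by
      rintro y ⟨⟨hyU, -⟩, hyΩ, hy⟩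
      have := hs y ⟨hyU, hyΩ⟩
      rw [mem_union, not_or, this.1, this.2] at hy
      linarith [hy.1, hy.2]
    exact fun y hy z hz' => h y hy.1.2 z hz'.1.2 (hz y hy) (hz z hz')
  choose! W hW hWm using hloc
  have hcomp : IsCompact (closure D.Γ) :=
    (D.isBounded_Ω.subset D.Γ_subset).isCompact_closure
  obtain ⟨s, hs, hcov⟩ := hcomp.elim_nhds_subcover W hW
  refine ⟨4 * (s.card + 1), by positivity, fun x r hr => ?_⟩
  calc Measure.hausdorffMeasure 1 (D.Γ ∩ Metric.closedBall x r)
      ≤ Measure.hausdorffMeasure 1 (⋃ i ∈ s, (W i ∩ D.Γ) ∩ Metric.closedBall x r) := by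
        refine measure_mono fun y hy => ?_
        have := hcov (subset_closure hy.1)
        simp only [mem_iUnion] at this ⊢
        obtain ⟨i, hi, hyi⟩ := this
        exact ⟨i, hi, ⟨hyi, hy.1⟩, hy.2⟩
    _ ≤ ∑ i ∈ s, Measure.hausdorffMeasure 1 ((W i ∩ D.Γ) ∩ Metric.closedBall x r) :=
        measure_biUnion_finset_le _ _
    _ ≤ ∑ i ∈ s, ENNReal.ofReal (4 * r) := Finset.sum_le_sum fun i hi => hWm i (hs i hi) x r
    _ = ENNReal.ofReal (s.card * (4 * r)) := by
        rw [Finset.sum_const, nsmul_eq_mul, ENNReal.ofReal_mul (Nat.cast_nonneg _),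
          ENNReal.ofReal_natCast]
    _ ≤ _ := ENNReal.ofReal_le_ofReal (by nlinarith)

lemma hausdorffMeasure_Γ_lt_top : Measure.hausdorffMeasure 1 D.Γ < ⊤ := by
  obtain ⟨L, -, hL⟩ := D.exists_length_le
  obtain ⟨R, hR⟩ := (D.isBounded_Ω.subset D.Γ_subset).subset_closedBall 0
  have h := hL 0 (max R 0) (le_max_right _ _)
  rw [inter_eq_left.2 (hR.trans (Metric.closedBall_subset_closedBall (le_max_left _ _)))] at h
  exact h.trans_lt ENNReal.ofReal_lt_top

lemma mem_closure_sub {x : Plane} (hx : x ∈ D.Γ) (m : Fin 2) : x ∈ closure (D.sub m) := by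
  obtain ⟨U, φ, hU, hxU, hφ, hg, hs⟩ := D.regular x (subset_closure hx)
  have hx0 : φ x = 0 := by
    have := hs x ⟨hxU, hx.1⟩
    have hn := hx.2
    rw [mem_union, not_or, this.1, this.2] at hn
    linarith [hn.1, hn.2]
  have hd := (hasStrictFDerivAt_of_contDiffOn hU hxU hφ).hasFDerivAt
  set g := ∇ φ x with hgdef
  have hgpos : 0 < ‖g‖ := norm_pos_iff.2 hg
  have key : ∀ e : ℝ, (0 < e → x ∈ closure (D.sub 0)) ∧ (e < 0 → x ∈ closure (D.sub 1)) := by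
    intro e
    have hline : HasDerivAt (fun s : ℝ => x + s • (e • g)) (e • g) 0 := by
      simpa using ((hasDerivAt_id (0 : ℝ)).smul_const (e • g)).const_add x
    have hd' : HasFDerivAt φ (InnerProductSpace.toDual ℝ Plane g) (x + (0 : ℝ) • (e • g)) := by
      simpa using hd
    have hcomp := hd'.comp_hasDerivAt (0 : ℝ) hline
    have hval : InnerProductSpace.toDual ℝ Plane g (e • g) = e * ‖g‖ ^ 2 := by
      simp [InnerProductSpace.toDual_apply_apply]
    rw [hval, hasDerivAt_iff_tendsto_slope] at hcomp
    have hcomp := hcomp.mono_left (nhdsWithin_mono (0 : ℝ)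
      (show Ioi (0 : ℝ) ⊆ {0}ᶜ from fun s hs => (ne_of_gt hs)))
    have hmem : ∀ᶠ s : ℝ in 𝓝[>] 0, x + s • (e • g) ∈ U ∩ D.Ω := by
      refine (hline.continuousAt.tendsto.mono_left nhdsWithin_le_nhds).eventually ?_
      simpa using (hU.inter D.isOpen_Ω).mem_nhds ⟨hxU, hx.1⟩
    have hlim : Tendsto (fun s : ℝ => x + s • (e • g)) (𝓝[>] 0) (𝓝 x) := by
      simpa using hline.continuousAt.tendsto.mono_left nhdsWithin_le_nhds
    constructor
    · intro he
      refine mem_closure_of_tendsto hlim ?_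
      filter_upwards [hmem, hcomp.eventually (lt_mem_nhds (by positivity : 0 < e * ‖g‖ ^ 2)),
        self_mem_nhdsWithin] with s h1 h2 h3
      rw [(hs _ h1).1]
      simp only [slope_def_field, Function.comp, zero_smul, add_zero, hx0, sub_zero] at h2
      exact (div_pos_iff_of_pos_right h3).1 h2
    · intro he
      refine mem_closure_of_tendsto hlim ?_
      filter_upwards [hmem, hcomp.eventually (gt_mem_nhds
        (mul_neg_of_neg_of_pos he (by positivity) : e * ‖g‖ ^ 2 < 0)),
        self_mem_nhdsWithin] with s h1 h2 h3
      rw [(hs _ h1).2]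
      simp only [slope_def_field, Function.comp, zero_smul, add_zero, hx0, sub_zero] at h2
      rw [div_lt_iff₀ h3, zero_mul] at h2
      exact h2
  fin_cases m
  · exact (key 1).1 one_pos
  · exact (key (-1)).2 (by norm_num)

end InterfaceDomain

/-! ### Counting crossings of horizontal lines with a set of finite length -/

/-- The index of the cell of the grid of width `1 / (k + 1)` that contains `z`. -/
def gridIndex (k : ℕ) (z : Plane) : ℤ × ℤ := (⌊((k : ℝ) + 1) * z 0⌋, ⌊((k : ℝ) + 1) * z 1⌋)

lemma measurable_gridIndex (k : ℕ) : Measurable (gridIndex k) := by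
  unfold gridIndex
  fun_prop

lemma dist_le_of_gridIndex_eq {k : ℕ} {z z' : Plane} (h : gridIndex k z = gridIndex k z') :
    dist z z' ≤ 2 / ((k : ℝ) + 1) := by
  have hk : (0 : ℝ) < (k : ℝ) + 1 := by positivity
  obtain ⟨h0, h1⟩ := Prod.mk.inj h
  have h0 := Int.abs_sub_lt_one_of_floor_eq_floor h0
  have h1 := Int.abs_sub_lt_one_of_floor_eq_floor h1
  rw [← mul_sub, abs_mul, abs_of_pos hk] at h0 h1
  have hsq : (((k : ℝ) + 1) * dist z z') ^ 2 ≤ 2 ^ 2 := by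
    rw [dist_eq_norm, mul_pow, norm_sq_plane, mul_add]
    simp only [PiLp.sub_apply]
    have e0 : (((k : ℝ) + 1) * |z 0 - z' 0|) ^ 2 ≤ 1 := pow_le_one₀ (by positivity) h0.le
    have e1 : (((k : ℝ) + 1) * |z 1 - z' 1|) ^ 2 ≤ 1 := pow_le_one₀ (by positivity) h1.le
    rw [mul_pow, sq_abs] at e0 e1
    linarith
  have := (sq_le_sq₀ (by positivity) (by positivity)).1 hsq
  rw [le_div_iff₀ hk]; linarith

lemma tendsto_two_div_add_one : Tendsto (fun k : ℕ => 2 / ((k : ℝ) + 1)) atTop (𝓝 0) :=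
  tendsto_const_nhds.div_atTop (tendsto_atTop_add_const_right _ _ tendsto_natCast_atTop_atTop)

lemma volume_image_apply_one_le (A : Set Plane) :
    volume ((fun z : Plane => z 1) '' A) ≤ Measure.hausdorffMeasure 1 A := by
  have hl : LipschitzWith 1 (fun z : Plane => z 1) := by
    refine LipschitzWith.of_dist_le_mul fun x y => ?_
    simp only [NNReal.coe_one, one_mul, dist_eq_norm]
    simpa using PiLp.norm_apply_le (x - y) 1
  have := hl.hausdorffMeasure_image_le zero_le_one A
  rwa [hausdorffMeasure_real, ENNReal.coe_one, ENNReal.one_rpow, one_mul] at this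

lemma exists_crossing_majorant {A : Set Plane} (hA : MeasurableSet A) {g : Plane → ENNReal}
    (hg : ContinuousOn g A) : ∃ S : ℝ → ENNReal, Measurable S ∧
      (∀ (y : ℝ) (F : Finset Plane), (F : Set Plane) ⊆ A → (∀ z ∈ F, z 1 = y) →
        ∑ z ∈ F, g z ≤ S y) ∧
      ∫⁻ y, S y ≤ ∫⁻ z in A, g z ∂(Measure.hausdorffMeasure 1) := by
  set μ : Measure Plane := Measure.hausdorffMeasure 1 with hμ
  let Q : ℕ → ℤ × ℤ → Set Plane := fun k i => A ∩ gridIndex k ⁻¹' {i}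
  let c : ℕ → ℤ × ℤ → ENNReal := fun k i => ⨅ z ∈ Q k i, g z
  let B : ℕ → ℤ × ℤ → Set ℝ := fun k i => toMeasurable volume ((fun z : Plane => z 1) '' Q k i)
  let Sk : ℕ → ℝ → ENNReal := fun k y => ∑' i, (B k i).indicator (fun _ => c k i) y
  have hQm : ∀ k i, MeasurableSet (Q k i) := fun k i =>
    hA.inter (measurable_gridIndex k (measurableSet_singleton i))
  have hSkm : ∀ k, Measurable (Sk k) := fun k =>
    Measurable.tsum fun i => measurable_const.indicator (measurableSet_toMeasurable _ _)
  have hSkint : ∀ k, ∫⁻ y, Sk k y ≤ ∫⁻ z in A, g z ∂μ := by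
    intro k
    have hAU : A = ⋃ i, Q k i := by
      ext z; simp [Q]
    calc ∫⁻ y, Sk k y = ∑' i, ∫⁻ y, (B k i).indicator (fun _ => c k i) y :=
          lintegral_tsum fun i =>
            (measurable_const.indicator (measurableSet_toMeasurable _ _)).aemeasurable
      _ = ∑' i, c k i * volume ((fun z : Plane => z 1) '' Q k i) := by
          congr with i
          rw [lintegral_indicator_const (measurableSet_toMeasurable _ _), measure_toMeasurable]
      _ ≤ ∑' i, ∫⁻ z in Q k i, g z ∂μ := by
          refine ENNReal.tsum_le_tsum fun i => ?_
          calc c k i * volume ((fun z : Plane => z 1) '' Q k i) ≤ c k i * μ (Q k i) := by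
                gcongr; exact volume_image_apply_one_le _
            _ = ∫⁻ _ in Q k i, c k i ∂μ := by simp
            _ ≤ _ := setLIntegral_mono' (hQm k i) fun z hz => iInf₂_le z hz
      _ = ∫⁻ z in A, g z ∂μ := by
          conv_rhs => rw [hAU]
          refine (lintegral_iUnion (hQm k) ?_ _).symm
          intro i j hij
          refine Set.disjoint_left.2 fun z hz hz' => hij ?_
          exact hz.2.symm.trans hz'.2
  refine ⟨fun y => liminf (fun k => Sk k y) atTop, Measurable.liminf hSkm, ?_, ?_⟩
  · intro y F hFA hFy
    have hc : ∀ z ∈ F, Tendsto (fun k => c k (gridIndex k z)) atTop (𝓝 (g z)) := by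
      intro z hz
      refine tendsto_order.2 ⟨fun a ha => ?_, fun a ha => ?_⟩
      · obtain ⟨b, hab, hb⟩ := exists_between ha
        have h1 := (hg z (hFA hz)).eventually (lt_mem_nhds hb)
        rw [Filter.Eventually, Metric.mem_nhdsWithin_iff] at h1
        obtain ⟨ε, hε, h1⟩ := h1
        filter_upwards [tendsto_two_div_add_one.eventually (gt_mem_nhds hε)] with k hk
        refine hab.trans_le (le_iInf₂ fun z' hz' => ?_)
        refine le_of_lt (h1 ⟨?_, hz'.1⟩)
        exact (dist_le_of_gridIndex_eq hz'.2).trans_lt hk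
      · refine Eventually.of_forall fun k => lt_of_le_of_lt ?_ ha
        exact iInf₂_le z ⟨hFA hz, rfl⟩
    have hinj : ∀ᶠ k in atTop, ∀ z ∈ F, ∀ z' ∈ F, z ≠ z' → gridIndex k z ≠ gridIndex k z' := by
      rw [Filter.eventually_all_finset]
      intro z _
      rw [Filter.eventually_all_finset]
      intro z' _
      by_cases hzz : z = z'
      · simp [hzz]
      · filter_upwards [tendsto_two_div_add_one.eventually (gt_mem_nhds (dist_pos.2 hzz))]
          with k hk _
        exact fun h => absurd (dist_le_of_gridIndex_eq h) (not_le.2 hk)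
    have hsum := tendsto_finsetSum F hc
    rw [← hsum.liminf_eq]
    refine liminf_le_liminf ?_
    filter_upwards [hinj] with k hk
    have hinjOn : InjOn (gridIndex k) F := by
      intro z hz z' hz' h
      by_contra hne
      exact hk z hz z' hz' hne h
    calc ∑ z ∈ F, c k (gridIndex k z)
        = ∑ i ∈ F.image (gridIndex k), c k i := by rw [Finset.sum_image hinjOn]
      _ = ∑ i ∈ F.image (gridIndex k), (B k i).indicator (fun _ => c k i) y := by
          refine Finset.sum_congr rfl fun i hi => ?_
          obtain ⟨z, hz, rfl⟩ := Finset.mem_image.1 hi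
          rw [indicator_of_mem]
          exact subset_toMeasurable _ _ ⟨z, ⟨hFA hz, rfl⟩, hFy z hz⟩
      _ ≤ Sk k y := ENNReal.sum_le_tsum _
  · calc ∫⁻ y, liminf (fun k => Sk k y) atTop ≤ liminf (fun k => ∫⁻ y, Sk k y) atTop :=
          lintegral_liminf_le hSkm
      _ ≤ liminf (fun _ : ℕ => ∫⁻ z in A, g z ∂μ) atTop :=
          liminf_le_liminf (Eventually.of_forall hSkint)
      _ = _ := liminf_const _

lemma ae_finite_crossings {A : Set Plane} (hA : MeasurableSet A)
    (hfin : Measure.hausdorffMeasure 1 A ≠ ⊤) : ∀ᵐ y : ℝ, {z ∈ A | z 1 = y}.Finite := by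
  obtain ⟨S, hSm, hS, hSint⟩ := exists_crossing_majorant hA (continuousOn_const (c := 1))
  have h1 : ∫⁻ y, S y ≠ ⊤ := by
    refine ne_top_of_le_ne_top hfin (hSint.trans ?_)
    simp
  filter_upwards [ae_lt_top hSm h1] with y hy
  by_contra hinf
  obtain ⟨n, hn⟩ := ENNReal.exists_nat_gt hy.ne
  obtain ⟨F, hF, hcard⟩ := Set.Infinite.exists_subset_card_eq hinf n
  have := hS y F (fun z hz => (hF hz).1) fun z hz => (hF hz).2
  simp only [Finset.sum_const, hcard, nsmul_eq_mul, mul_one] at this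
  exact absurd this (not_le.2 hn)

/-! ### Functions of one variable with jumps -/

lemma sq_sub_sq_le_lintegral {f : ℝ → ℝ} {a b M : ℝ} (hab : a ≤ b) (hf : ContinuousOn f (Icc a b))
    {E : Set ℝ} (hE : E.Countable)
    (hd : ∀ s ∈ Ioo a b \ E, DifferentiableAt ℝ f s ∧ |deriv f s| ≤ M)
    {d : ℝ → ENNReal}
    (hle : ∀ᵐ s, s ∈ Ioo a b → ENNReal.ofReal (2 * |f s| * |deriv f s|) ≤ d s)
    (hfin : ∫⁻ s in Ioc a b, d s ≠ ⊤) :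
    f b ^ 2 - f a ^ 2 ≤ (∫⁻ s in Ioc a b, d s).toReal := by
  set F : ℝ → ℝ := fun s => 2 * f s * deriv f s with hF
  obtain ⟨B, hB⟩ := isCompact_Icc.exists_bound_of_continuousOn hf
  have hae : ∀ᵐ s ∂volume.restrict (Ioc a b), s ∈ Ioo a b \ E := by
    rw [← restrict_Ioo_eq_restrict_Ioc]
    filter_upwards [ae_restrict_mem measurableSet_Ioo,
      ae_restrict_of_ae (hE.ae_notMem volume)] with s h1 h2 using ⟨h1, h2⟩
  have hInt : IntegrableOn F (Ioc a b) := by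
    refine Integrable.of_bound (C := 2 * B * M) ?_ ?_
    · refine ((aestronglyMeasurable_const (b := (2 : ℝ))).mul ?_).mul
        (measurable_deriv f).aestronglyMeasurable
      exact ((hf.mono Ioc_subset_Icc_self).aestronglyMeasurable measurableSet_Ioc)
    · filter_upwards [hae] with s hs
      have h1 := hB s (Ioo_subset_Icc_self hs.1)
      have h2 := (hd s hs).2
      rw [Real.norm_eq_abs] at h1 ⊢
      rw [hF, abs_mul, abs_mul, abs_two]
      have := abs_nonneg (f s)
      gcongr
      linarith
  have hftc : ∫ s in a..b, F s = f b ^ 2 - f a ^ 2 := by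
    refine integral_eq_of_hasDerivAt_off_countable_of_le (fun s => f s ^ 2) F hab hE (hf.pow 2)
      (fun s hs => ?_) ((intervalIntegrable_iff_integrableOn_Ioc_of_le hab).2 hInt)
    simpa [hF] using (hd s hs).1.hasDerivAt.fun_pow 2
  rw [← hftc, intervalIntegral.integral_of_le hab]
  calc ∫ s in Ioc a b, F s ≤ ‖∫ s in Ioc a b, F s‖ := Real.le_norm_self _
    _ ≤ ∫ s in Ioc a b, ‖F s‖ := norm_integral_le_integral_norm _
    _ = (∫⁻ s in Ioc a b, ‖F s‖ₑ).toReal := by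
        rw [integral_norm_eq_lintegral_enorm hInt.aestronglyMeasurable]
    _ ≤ _ := by
        refine ENNReal.toReal_mono hfin (lintegral_mono_ae ?_)
        filter_upwards [hae, ae_restrict_of_ae hle] with s h1 h2
        refine le_trans (le_of_eq ?_) (h2 h1.1)
        rw [← ofReal_norm, Real.norm_eq_abs, hF, abs_mul, abs_mul, abs_two]

lemma le_add_sum_crossings {l r : ℝ} {S : Fin 2 → Set ℝ} {F : Finset ℝ} {w : Fin 2 → ℝ → ℝ}
    {Φ : ℝ → ℝ} (hS : ∀ s ∈ Ioo l r, s ∈ F ∨ s ∈ S 0 ∪ S 1) (hSo : ∀ m, IsOpen (S m))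
    (hdisj : Disjoint (S 0) (S 1)) (hFS : ∀ m, ∀ s ∈ F, s ∉ S m) (hΦ0 : ∀ s, 0 ≤ Φ s)
    (hΦ : Monotone Φ)
    (hw : ∀ m, ContinuousOn (w m) (Icc l r))
    (h0 : ∀ m, ∀ b ∈ Ioo l r, Ioc l b ⊆ S m → w m l ≤ 0)
    (hstep : ∀ m a b, l < a → a ≤ b → b < r → Icc a b ⊆ S m → w m b ≤ w m a + (Φ b - Φ a)) :
    ∀ m, ∀ a ∈ Ioo l r, a ∈ S m → w m a ≤ Φ a + ∑ z ∈ F with l < z ∧ z < a, |w 0 z - w 1 z| := by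
  have hconn : ∀ (I : Set ℝ), IsPreconnected I → I ⊆ Ioo l r → (∀ s ∈ I, s ∉ F) →
      ∀ m, ∀ a ∈ I, a ∈ S m → I ⊆ S m := by
    intro I hI hIl hIF m a ha ham
    have hcov : I ⊆ S 0 ∪ S 1 := fun s hs => (hS s (hIl hs)).resolve_left (hIF s hs)
    rcases hI.subset_or_subset (hSo 0) (hSo 1) hdisj hcov with h | h
    · fin_cases m
      · exact h
      · exact absurd ham (Set.disjoint_left.1 hdisj (h ha))
    · fin_cases m
      · exact absurd (h ha) (Set.disjoint_left.1 hdisj ham)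
      · exact h
  have hstep' : ∀ m z a, l ≤ z → z < a → a < r → Ioc z a ⊆ S m →
      w m a ≤ w m z + (Φ a - Φ z) := by
    intro m z a hlz hza har hsub
    have hlim : Tendsto (fun s => w m s + (Φ a - Φ z)) (𝓝[>] z) (𝓝 (w m z + (Φ a - Φ z))) := by
      refine Tendsto.add_const _ ?_
      refine ((hw m z ⟨hlz, (hza.trans har).le⟩).mono_left ?_)
      rw [← nhdsWithin_Ioo_eq_nhdsGT (hza.trans har)]
      exact nhdsWithin_mono _ fun s hs => ⟨hlz.trans hs.1.le, hs.2.le⟩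
    refine ge_of_tendsto hlim ?_
    filter_upwards [Ioo_mem_nhdsGT hza] with s hs
    have := hstep m s a (hlz.trans_lt hs.1) hs.2.le har
      fun u hu => hsub ⟨hs.1.trans_le hu.1, hu.2⟩
    linarith [hΦ hs.1.le]
  suffices H : ∀ n : ℕ, ∀ m, ∀ a ∈ Ioo l r, a ∈ S m → (F.filter fun z => l < z ∧ z < a).card ≤ n →
      w m a ≤ Φ a + ∑ z ∈ F with l < z ∧ z < a, |w 0 z - w 1 z| from
    fun m a ha ham => H _ m a ha ham le_rfl
  intro n
  induction n with
  | zero =>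
    intro m a ha ham hcard
    have hemp : (F.filter fun z => l < z ∧ z < a) = ∅ := Finset.card_eq_zero.1 (Nat.le_zero.1 hcard)
    have hsub : Ioc l a ⊆ S m := by
      refine hconn _ isPreconnected_Ioc (fun s hs => ⟨hs.1, hs.2.trans_lt ha.2⟩)
        (fun s hs hsF => ?_)
        m a ⟨ha.1, le_rfl⟩ ham
      rcases hs.2.eq_or_lt with rfl | hlt
      · exact hFS m s hsF ham
      · have : s ∈ F.filter fun z => l < z ∧ z < a := Finset.mem_filter.2 ⟨hsF, hs.1, hlt⟩
        rw [hemp] at this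
        simp at this
    have h1 := hstep' m l a le_rfl ha.1 ha.2 hsub
    have h2 := h0 m a ha hsub
    rw [hemp, Finset.sum_empty]
    linarith [hΦ0 l]
  | succ n ih =>
    intro m a ha ham hcard
    by_cases hemp : (F.filter fun z => l < z ∧ z < a).Nonempty
    swap
    · rw [Finset.not_nonempty_iff_eq_empty] at hemp
      exact ih m a ha ham (by simp [hemp])
    set z := (F.filter fun z => l < z ∧ z < a).max' hemp with hz
    have hzmem := Finset.max'_mem _ hemp
    rw [← hz, Finset.mem_filter] at hzmem
    obtain ⟨hzF, hlz, hza⟩ := hzmem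
    have hzr : z < r := hza.trans ha.2
    have hfilt : ∀ s, s ≤ z → (F.filter fun u => l < u ∧ u < s) ⊆
        (F.filter fun u => l < u ∧ u < a).erase z := by
      intro s hs u hu
      rw [Finset.mem_filter] at hu
      rw [Finset.mem_erase, Finset.mem_filter]
      exact ⟨(hu.2.2.trans_le hs).ne, hu.1, hu.2.1, (hu.2.2.trans_le hs).trans hza⟩
    have hzin : z ∈ F.filter fun u => l < u ∧ u < a := Finset.mem_filter.2 ⟨hzF, hlz, hza⟩
    have hright : w m a ≤ w m z + (Φ a - Φ z) := by
      refine hstep' m z a hlz.le hza ha.2 (hconn _ isPreconnected_Ioc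
        (fun s hs => ⟨hlz.trans hs.1, hs.2.trans_lt ha.2⟩) (fun s hs hsF => ?_)
        m a ⟨hza, le_rfl⟩ ham)
      rcases hs.2.eq_or_lt with rfl | hlt
      · exact hFS m s hsF ham
      · exact absurd (Finset.le_max' _ s (Finset.mem_filter.2 ⟨hsF, hlz.trans hs.1, hlt⟩))
          (not_le.2 hs.1)
    have hnear : ∀ᶠ s in 𝓝[<] z, s ∉ F ∧ s ∈ Ioo l z := by
      have h1 : ∀ᶠ s in 𝓝[<] z, s ∉ F := by
        have hc : IsClosed ((F.erase z : Finset ℝ) : Set ℝ) := (F.erase z).finite_toSet.isClosed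
        have : ∀ᶠ s in 𝓝 z, s ∉ F.erase z := hc.isOpen_compl.mem_nhds (by simp)
        filter_upwards [this.filter_mono nhdsWithin_le_nhds, self_mem_nhdsWithin] with s hs hsz hsF
        exact hs (Finset.mem_erase.2 ⟨ne_of_lt hsz, hsF⟩)
      exact h1.and (Ioo_mem_nhdsLT hlz)
    obtain ⟨z', hz', hsub'⟩ := (mem_nhdsLT_iff_exists_Ioo_subset' hlz).1 hnear
    have hz'mem : ∀ s ∈ Ioo z' z, s ∈ Ioo l r := fun s hs =>
      ⟨(hsub' hs).2.1, hs.2.trans hzr⟩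
    obtain ⟨u, hu⟩ := exists_between (show z' < z from hz')
    obtain ⟨m', hum'⟩ : ∃ m', u ∈ S m' := by
      rcases (hS u (hz'mem u hu)).resolve_left (hsub' hu).1 with h | h
      exacts [⟨0, h⟩, ⟨1, h⟩]
    have hI := hconn (Ioo z' z) isPreconnected_Ioo (fun s hs => hz'mem s hs)
      (fun s hs => (hsub' hs).1) m' u hu hum'
    have hleft : w m' z ≤ Φ z + ∑ v ∈ (F.filter fun u => l < u ∧ u < a).erase z,
        |w 0 v - w 1 v| := by
      have hlim : Tendsto (w m') (𝓝[<] z) (𝓝 (w m' z)) := by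
        refine (hw m' z ⟨hlz.le, hzr.le⟩).mono_left ?_
        rw [← nhdsWithin_Ioo_eq_nhdsLT hlz]
        exact nhdsWithin_mono _ fun s hs => ⟨hs.1.le, (hs.2.trans hzr).le⟩
      refine le_of_tendsto hlim ?_
      filter_upwards [Ioo_mem_nhdsLT (show z' < z from hz')] with s hs
      refine (ih m' s (hz'mem s hs) (hI hs) ?_).trans ?_
      · have := Finset.card_le_card (hfilt s hs.2.le)
        rw [Finset.card_erase_of_mem hzin] at this
        omega
      · exact add_le_add (hΦ hs.2.le)
          (Finset.sum_le_sum_of_subset_of_nonneg (hfilt s hs.2.le) fun _ _ _ => abs_nonneg _)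
    have hjump : w m z ≤ w m' z + |w 0 z - w 1 z| := by
      have h1 := le_abs_self (w 0 z - w 1 z)
      have h2 := neg_abs_le (w 0 z - w 1 z)
      have h3 := abs_nonneg (w 0 z - w 1 z)
      fin_cases m <;> fin_cases m' <;> simp only [Fin.zero_eta, Fin.mk_one] <;> linarith
    rw [← Finset.sum_erase_add _ _ hzin]
    linarith

/-! ### Metric facts on triangles and triangulations -/

lemma isCompact_hull (s : Finset Plane) : IsCompact (hull s) :=
  s.finite_toSet.isCompact_convexHull ℝ

lemma convex_hull (s : Finset Plane) : Convex ℝ (hull s) := convex_convexHull ℝ _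

lemma measurableSet_hull (s : Finset Plane) : MeasurableSet (hull s) :=
  (isCompact_hull s).isClosed.measurableSet

lemma volume_hull_ne_top (s : Finset Plane) : volume (hull s) ≠ ⊤ :=
  (isCompact_hull s).measure_lt_top.ne

lemma dist_le_hT {T : Finset Plane} {x y : Plane} (hx : x ∈ hull T) (hy : y ∈ hull T) :
    dist x y ≤ hT T :=
  Metric.dist_le_diam_of_mem (isCompact_hull T).isBounded hx hy

lemma volume_hull_of_card_le_two {s : Finset Plane} (hs : s.card ≤ 2) : volume (hull s) = 0 := by
  rcases s.eq_empty_or_nonempty with rfl | hne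
  · simp [hull]
  · refine measure_mono_null (convexHull_subset_affineSpan _)
      (Measure.addHaar_affineSubspace _ _ ?_)
    intro htop
    have hc : s.card = (s.card - 1) + 1 := by have := hne.card_pos; omega
    have h1 := finrank_vectorSpan_image_finset_le ℝ (id : Plane → Plane) s hc
    rw [Finset.image_id, ← direction_affineSpan, htop, AffineSubspace.direction_top, finrank_top,
      finrank_euclideanSpace_fin] at h1
    omega

namespace Triangulation

variable {Ω : Set Plane} (𝒯 : Triangulation Ω)

lemma mem_triangles {T : Finset Plane} :
    T ∈ 𝒯.triangles ↔ T ∈ 𝒯.complex.faces ∧ T.card = 3 := by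
  simp [triangles]

lemma card_le_three {T : Finset Plane} (hT : T ∈ 𝒯.complex.faces) : T.card ≤ 3 := by
  have h := (𝒯.complex.indep hT).card_le_finrank_succ
  have h2 := Submodule.finrank_le (vectorSpan ℝ (range ((↑) : T → Plane)))
  rw [finrank_euclideanSpace_fin] at h2
  simp only [Fintype.card_coe] at h
  omega

lemma hull_subset_closure {T : Finset Plane} (hT : T ∈ 𝒯.triangles) : hull T ⊆ closure Ω := by
  rw [← 𝒯.space_eq]
  exact Geometry.SimplicialComplex.convexHull_subset_space (𝒯.mem_triangles.1 hT).1

lemma interior_hull_nonempty {T : Finset Plane} (hT : T ∈ 𝒯.triangles) :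
    (interior (hull T)).Nonempty := by
  obtain ⟨hf, hc⟩ := 𝒯.mem_triangles.1 hT
  rw [hull, interior_convexHull_nonempty_iff_affineSpan_eq_top]
  have := (𝒯.complex.indep hf).affineSpan_eq_top_iff_card_eq_finrank_add_one
  simp only [Subtype.range_coe_subtype, Finset.setOfPred_mem] at this
  rw [this]
  simp [hc]

lemma volume_real_hull_pos {T : Finset Plane} (hT : T ∈ 𝒯.triangles) :
    0 < volume.real (hull T) := by
  refine ENNReal.toReal_pos (ne_of_gt ?_) (volume_hull_ne_top T)
  exact (isOpen_interior.measure_pos volume (𝒯.interior_hull_nonempty hT)).trans_le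
    (measure_mono interior_subset)

lemma volume_hull_inter_hull {T T' : Finset Plane} (hT : T ∈ 𝒯.triangles)
    (hT' : T' ∈ 𝒯.triangles) (hne : T ≠ T') : volume (hull T ∩ hull T') = 0 := by
  obtain ⟨hf, hc⟩ := 𝒯.mem_triangles.1 hT
  obtain ⟨hf', hc'⟩ := 𝒯.mem_triangles.1 hT'
  have h := 𝒯.complex.inter_subset_convexHull hf hf'
  rw [← Finset.coe_inter] at h
  refine measure_mono_null h (volume_hull_of_card_le_two ?_)
  have h1 : T ∩ T' ⊂ T := by
    refine Finset.inter_subset_left.ssubset_of_ne fun heq => hne ?_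
    exact Finset.eq_of_subset_of_card_le (Finset.inter_eq_left.1 heq) (by omega)
  have := Finset.card_lt_card h1
  omega

lemma pairwise_aedisjoint :
    (𝒯.triangles : Set (Finset Plane)).Pairwise (Function.onFun (AEDisjoint volume) hull) :=
  fun _ hT _ hT' hne => 𝒯.volume_hull_inter_hull hT hT' hne

lemma volume_closure_diff : volume (closure Ω \ ⋃ T ∈ 𝒯.triangles, hull T) = 0 := by
  refine measure_mono_null (t := ⋃ s ∈ 𝒯.finite.toFinset.filter fun s => s.card ≤ 2, hull s) ?_ ?_
  · rintro x ⟨hx, hxT⟩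
    rw [← 𝒯.space_eq, Geometry.SimplicialComplex.mem_space_iff] at hx
    obtain ⟨s, hs, hxs⟩ := hx
    simp only [mem_iUnion] at hxT ⊢
    refine ⟨s, Finset.mem_filter.2 ⟨by simpa using hs, ?_⟩, hxs⟩
    have h3 := 𝒯.card_le_three hs
    by_contra hcard
    exact hxT ⟨s, 𝒯.mem_triangles.2 ⟨hs, by omega⟩, hxs⟩
  · refine (measure_biUnion_null_iff (Finset.countable_toSet _)).2 fun s hs => ?_
    exact volume_hull_of_card_le_two (Finset.mem_filter.1 hs).2

lemma isClosed_iUnion_hull : IsClosed (⋃ T ∈ 𝒯.triangles, hull T) :=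
  isClosed_biUnion_finset fun T _ => (isCompact_hull T).isClosed

lemma closure_subset_iUnion_hull (hΩ : IsOpen Ω) : closure Ω ⊆ ⋃ T ∈ 𝒯.triangles, hull T := by
  refine closure_minimal ?_ 𝒯.isClosed_iUnion_hull
  rw [← sdiff_eq_empty]
  have hopen : IsOpen (Ω \ ⋃ T ∈ 𝒯.triangles, hull T) := hΩ.sdiff 𝒯.isClosed_iUnion_hull
  rw [← hopen.measure_eq_zero_iff volume]
  exact measure_mono_null (sdiff_subset_sdiff_left subset_closure) 𝒯.volume_closure_diff

lemma triangles_nonempty (hΩ : IsOpen Ω) (hne : Ω.Nonempty) : 𝒯.triangles.Nonempty := by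
  obtain ⟨x, hx⟩ := hne
  have := 𝒯.closure_subset_iUnion_hull hΩ (subset_closure hx)
  simp only [mem_iUnion] at this
  obtain ⟨T, hT, -⟩ := this
  exact ⟨T, hT⟩

lemma hT_le_meshSize {T : Finset Plane} (hT : T ∈ 𝒯.triangles) : NitscheXFEM.hT T ≤ 𝒯.meshSize :=
  le_csSup ((Finset.finite_toSet _).image _).bddAbove (mem_image_of_mem _ hT)

lemma exists_hT_eq_meshSize (hne : 𝒯.triangles.Nonempty) :
    ∃ T ∈ 𝒯.triangles, NitscheXFEM.hT T = 𝒯.meshSize :=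
  ((Finset.coe_nonempty.2 hne).image _).csSup_mem ((Finset.finite_toSet _).image _)

end Triangulation

lemma bddAbove_inDiam (T : Finset Plane) :
    BddAbove {d : ℝ | 0 ≤ d ∧ ∃ x, Metric.closedBall x (d / 2) ⊆ hull T} := by
  refine ⟨hT T, ?_⟩
  rintro d ⟨hd, x, hx⟩
  have := Metric.diam_mono hx (isCompact_hull T).isBounded
  rw [Metric.diam_closedBall_eq x (by positivity)] at this
  exact (by linarith : d ≤ Metric.diam (hull T))

lemma inDiam_pos {T : Finset Plane} (hT : (interior (hull T)).Nonempty) : 0 < inDiam T := by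
  obtain ⟨x, hx⟩ := hT
  obtain ⟨ε, hε, hball⟩ := Metric.nhds_basis_closedBall.mem_iff.1 (mem_interior_iff_mem_nhds.1 hx)
  have : 2 * ε ≤ inDiam T :=
    le_csSup (bddAbove_inDiam T) ⟨by positivity, x, by simpa using hball⟩
  linarith

lemma inDiam_le_hT {T : Finset Plane} (hT' : (interior (hull T)).Nonempty) : inDiam T ≤ hT T := by
  refine csSup_le ?_ ?_
  · obtain ⟨x, hx⟩ := hT'
    exact ⟨0, le_rfl, x, by simpa using interior_subset hx⟩
  · rintro d ⟨hd, x, hx⟩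
    have := Metric.diam_mono hx (isCompact_hull T).isBounded
    rw [Metric.diam_closedBall_eq x (by positivity)] at this
    exact (by linarith : d ≤ Metric.diam (hull T))

lemma inDiam_sq_le {T : Finset Plane} (hT : (interior (hull T)).Nonempty) :
    inDiam T ^ 2 ≤ 16 * volume.real (hull T) := by
  have hpos := inDiam_pos hT
  obtain ⟨d, ⟨hd, x, hx⟩, hlt⟩ := exists_lt_of_lt_csSup
    (by obtain ⟨y, hy⟩ := hT; exact ⟨0, le_rfl, y, by simpa using interior_subset hy⟩)
    (half_lt_self hpos)
  have h1 : volume.real (Metric.closedBall x (d / 2)) ≤ volume.real (hull T) :=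
    measureReal_mono hx (volume_hull_ne_top T)
  rw [measureReal_def, EuclideanSpace.volume_closedBall_fin_two, ENNReal.toReal_mul,
    ENNReal.toReal_pow, ENNReal.toReal_ofReal (by positivity),
    ENNReal.toReal_ofReal Real.pi_pos.le] at h1
  have h2 : (inDiam T / 2) ^ 2 ≤ d ^ 2 := by
    have : inDiam T / 2 ≤ d := hlt.le
    gcongr
  nlinarith [Real.pi_gt_three, sq_nonneg d]

namespace Triangulation

variable {Ω : Set Plane} (𝒯 : Triangulation Ω)

lemma hT_pos {T : Finset Plane} (hT : T ∈ 𝒯.triangles) : 0 < NitscheXFEM.hT T :=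
  (inDiam_pos (𝒯.interior_hull_nonempty hT)).trans_le (inDiam_le_hT (𝒯.interior_hull_nonempty hT))

lemma meshSize_pos (hΩ : IsOpen Ω) (hne : Ω.Nonempty) : 0 < 𝒯.meshSize := by
  obtain ⟨T, hT⟩ := 𝒯.triangles_nonempty hΩ hne
  exact (𝒯.hT_pos hT).trans_le (𝒯.hT_le_meshSize hT)

lemma meshSize_le_diam (hΩ : IsOpen Ω) (hne : Ω.Nonempty) (hb : Bornology.IsBounded Ω) :
    𝒯.meshSize ≤ Metric.diam Ω := by
  obtain ⟨T, hT, h⟩ := 𝒯.exists_hT_eq_meshSize (𝒯.triangles_nonempty hΩ hne)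
  rw [← h, ← Metric.diam_closure]
  exact Metric.diam_mono (𝒯.hull_subset_closure hT) hb.closure

lemma meshSize_sq_le (hΩ : IsOpen Ω) (hne : Ω.Nonempty) {σ τ : ℝ} (hσ : 𝒯.ShapeRegular σ)
    (hτ : 𝒯.QuasiUniform τ) {T : Finset Plane} (hT : T ∈ 𝒯.triangles) :
    𝒯.meshSize ^ 2 ≤ (16 * σ ^ 2 * τ ^ 2 + 1) * volume.real (hull T) := by
  have hint := 𝒯.interior_hull_nonempty hT
  have h1 := (div_le_iff₀ (inDiam_pos hint)).1 (hσ T hT)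
  have h2 := hτ T hT
  have h3 := inDiam_sq_le hint
  have hpos := 𝒯.meshSize_pos hΩ hne
  have hTpos := 𝒯.hT_pos hT
  have hτ0 : 0 < τ := by
    by_contra hneg
    nlinarith [mul_nonneg (neg_nonneg.2 (not_lt.1 hneg)) hTpos.le]
  have h4 : 𝒯.meshSize ≤ τ * (σ * inDiam T) := h2.trans (by gcongr)
  have hv := 𝒯.volume_real_hull_pos hT
  calc 𝒯.meshSize ^ 2 ≤ (τ * (σ * inDiam T)) ^ 2 := by gcongr
    _ = σ ^ 2 * τ ^ 2 * inDiam T ^ 2 := by ring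
    _ ≤ σ ^ 2 * τ ^ 2 * (16 * volume.real (hull T)) := by gcongr
    _ ≤ _ := by nlinarith

lemma card_le_of_mem (hΩ : IsOpen Ω) (hne : Ω.Nonempty) {K : ℝ}
    (hK : ∀ T ∈ 𝒯.triangles, 𝒯.meshSize ^ 2 ≤ K * volume.real (hull T)) (hK0 : 0 ≤ K) (x : Plane)
    {s : Finset (Finset Plane)} (hs : s ⊆ 𝒯.triangles) (hx : ∀ T ∈ s, x ∈ hull T) :
    (s.card : ℝ) ≤ 4 * K := by
  have hpos := 𝒯.meshSize_pos hΩ hne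
  have h1 : volume.real (⋃ T ∈ s, hull T) = ∑ T ∈ s, volume.real (hull T) := by
    rw [measureReal_def, measure_biUnion_finset₀ (𝒯.pairwise_aedisjoint.mono (by exact_mod_cast hs))
      fun T _ => (measurableSet_hull T).nullMeasurableSet,
      ENNReal.toReal_sum fun T _ => volume_hull_ne_top T]
    rfl
  have h2 : volume.real (⋃ T ∈ s, hull T) ≤ volume.real (Metric.closedBall x 𝒯.meshSize) := by
    refine measureReal_mono (iUnion₂_subset fun T hT y hy => ?_)
      (isCompact_closedBall _ _).measure_lt_top.ne
    exact (dist_le_hT hy (hx T hT)).trans (𝒯.hT_le_meshSize (hs hT))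
  rw [measureReal_def (s := Metric.closedBall _ _), EuclideanSpace.volume_closedBall_fin_two,
    ENNReal.toReal_mul, ENNReal.toReal_pow, ENNReal.toReal_ofReal hpos.le,
    ENNReal.toReal_ofReal Real.pi_pos.le, h1] at h2
  have h3 : (s.card : ℝ) * 𝒯.meshSize ^ 2 ≤ K * ∑ T ∈ s, volume.real (hull T) := by
    rw [Finset.mul_sum, ← nsmul_eq_mul]
    exact Finset.card_nsmul_le_sum _ _ _ fun T hT => hK T (hs hT)
  have h4 : (s.card : ℝ) * 𝒯.meshSize ^ 2 ≤ (4 * K) * 𝒯.meshSize ^ 2 := by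
    refine h3.trans ((mul_le_mul_of_nonneg_left h2 hK0).trans ?_)
    nlinarith [Real.pi_le_four, mul_nonneg hK0 (sq_nonneg 𝒯.meshSize)]
  exact le_of_mul_le_mul_right h4 (by positivity)

end Triangulation

/-! ### Splitting a function of the extended space into its two sides -/

/-- On `Ω_m` the function `v` coincides with the continuous function `V m`, which is affine on each
element `T` with gradient `G m T` and vanishes on the part of `∂Ω` that is adherent to `Ω_m`. -/
structure IsSplit (D : InterfaceDomain) (𝒯 : Triangulation D.Ω) (v : Plane → ℝ)
    (V : Fin 2 → Plane → ℝ) (G : Fin 2 → Finset Plane → Plane) : Prop where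
  continuousOn : ∀ m, ContinuousOn (V m) (closure D.Ω)
  affine : ∀ m, ∀ T ∈ 𝒯.triangles, ∀ x ∈ hull T, ∀ y ∈ hull T, V m y = V m x + ⟪G m T, y - x⟫
  eqOn : ∀ m, EqOn v (V m) (D.sub m)
  boundary : ∀ m, ∀ x ∈ frontier D.Ω, x ∈ closure (D.sub m) → V m x = 0

variable {D : InterfaceDomain} {𝒯 : Triangulation D.Ω}

lemma exists_eqOn_sub {v : Plane → ℝ} (hv : v ∈ 𝒯.linearSpace ⊔ cutSpace D 𝒯) :
    ∃ V : Fin 2 → Plane → ℝ, (∀ m, V m ∈ 𝒯.linearSpace) ∧ ∀ m, EqOn v (V m) (D.sub m) := by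
  obtain ⟨a, ha, b, hb, rfl⟩ := Submodule.mem_sup.1 hv
  suffices H : ∃ V : Fin 2 → Plane → ℝ, (∀ m, V m ∈ 𝒯.linearSpace) ∧
      ∀ m, EqOn b (V m) (D.sub m) by
    obtain ⟨V, hV, hVe⟩ := H
    exact ⟨fun m => a + V m, fun m => Submodule.add_mem _ ha (hV m), fun m x hx => by
      simp [hVe m hx]⟩
  refine Submodule.span_induction (p := fun b _ => ∃ V : Fin 2 → Plane → ℝ,
    (∀ m, V m ∈ 𝒯.linearSpace) ∧ ∀ m, EqOn b (V m) (D.sub m)) ?_ ?_ ?_ ?_ hb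
  · rintro w ⟨P, -, φ, hφ, -, m', -, rfl⟩
    refine ⟨fun m => if m = m' then 0 else φ, fun m => ?_, fun m x hx => ?_⟩
    · dsimp only
      split_ifs
      · exact Submodule.zero_mem _
      · exact hφ.1
    · by_cases h : m = m'
      · subst h
        simp [hx]
      · have : x ∉ D.sub m' := Set.disjoint_left.1 (D.disjoint_sub h) hx
        simp [h, this, D.sub_subset m hx]
  · exact ⟨0, fun m => Submodule.zero_mem _, fun m x _ => rfl⟩
  · rintro x y - - ⟨V, hV, hVe⟩ ⟨W, hW, hWe⟩
    exact ⟨V + W, fun m => Submodule.add_mem _ (hV m) (hW m), fun m z hz => by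
      simp [hVe m hz, hWe m hz]⟩
  · rintro c x - ⟨V, hV, hVe⟩
    exact ⟨c • V, fun m => Submodule.smul_mem _ c (hV m), fun m z hz => by simp [hVe m hz]⟩

lemma exists_isSplit {v : Plane → ℝ} (hv : v ∈ xfemSpace D 𝒯) : ∃ V G, IsSplit D 𝒯 v V G := by
  obtain ⟨V, hV, hVe⟩ := exists_eqOn_sub hv.1
  have hA : ∀ m, ∀ T ∈ 𝒯.triangles, ∃ g : Plane, ∀ x ∈ hull T, ∀ y ∈ hull T,
      V m y = V m x + ⟪g, y - x⟫ := by
    intro m T hT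
    obtain ⟨A, hA⟩ := (hV m).2.2 T hT
    refine ⟨(InnerProductSpace.toDual ℝ Plane).symm (LinearMap.toContinuousLinearMap A.linear),
      fun x hx y hy => ?_⟩
    rw [hA hx, hA hy, InnerProductSpace.toDual_symm_apply, LinearMap.coe_toContinuousLinearMap',
      ← vsub_eq_sub, A.linearMap_vsub, vsub_eq_sub]
    ring
  choose! G hG using hA
  refine ⟨V, G, fun m => (hV m).1, hG, hVe, fun m x hx hxm => ?_⟩
  have : (𝓝[D.sub m] x).NeBot := mem_closure_iff_nhdsWithin_neBot.1 hxm
  have h1 : Tendsto v (𝓝[D.sub m] x) (𝓝 0) := (hv.2 x hx).mono_left (nhdsWithin_mono _ (by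
    fin_cases m
    · exact subset_union_left
    · exact subset_union_right))
  have h2 : Tendsto (V m) (𝓝[D.sub m] x) (𝓝 (V m x)) :=
    ((hV m).1 x (frontier_subset_closure hx)).mono_left
      (nhdsWithin_mono _ ((D.sub_subset m).trans subset_closure))
  exact tendsto_nhds_unique (h2.congr' ((hVe m).symm.eventuallyEq_of_mem self_mem_nhdsWithin)) h1

lemma ae_mem_interior_hull (T : Finset Plane) (s : Set Plane) :
    ∀ᵐ x ∂volume.restrict (hull T ∩ s), x ∈ interior (hull T) := by
  have h : ∀ᵐ x : Plane, x ∉ frontier (hull T) :=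
    measure_eq_zero_iff_ae_notMem.1 ((convex_hull T).addHaar_frontier volume)
  filter_upwards [ae_restrict_of_ae h, ae_restrict_of_ae_restrict_of_subset inter_subset_left
    (ae_restrict_mem (measurableSet_hull T))] with x hx hxT
  by_contra hxi
  exact hx ⟨subset_closure hxT, hxi⟩

namespace InterfaceDomain

variable (D) (𝒯)

lemma restrict_sub (m : Fin 2) : (volume : Measure Plane).restrict (D.sub m) =
    ∑ T ∈ 𝒯.triangles, volume.restrict (hull T ∩ D.sub m) := by
  have hU : D.sub m = ⋃ T : 𝒯.triangles, hull T.1 ∩ D.sub m := by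
    ext x
    constructor
    · intro hx
      have := 𝒯.closure_subset_iUnion_hull D.isOpen_Ω (subset_closure (D.sub_subset m hx))
      simp only [mem_iUnion] at this ⊢
      obtain ⟨T, hT, hxT⟩ := this
      exact ⟨⟨T, hT⟩, hxT, hx⟩
    · simp only [mem_iUnion]
      rintro ⟨T, hT⟩
      exact hT.2
  conv_lhs => rw [hU]
  rw [Measure.restrict_iUnion_ae, Measure.sum_fintype, Finset.sum_coe_sort 𝒯.triangles
    fun T => (volume : Measure Plane).restrict (hull T ∩ D.sub m)]
  · intro T T' hne
    refine measure_mono_null (inter_subset_inter inter_subset_left inter_subset_left) ?_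
    exact 𝒯.volume_hull_inter_hull T.2 T'.2 fun h => hne (Subtype.ext h)
  · exact fun T => ((measurableSet_hull _).inter (D.measurableSet_sub m)).nullMeasurableSet

end InterfaceDomain

lemma volume_inter_ne_top (T : Finset Plane) (s : Set Plane) : volume (hull T ∩ s) ≠ ⊤ :=
  measure_ne_top_of_subset inter_subset_left (volume_hull_ne_top T)

namespace IsSplit

variable {v : Plane → ℝ} {V : Fin 2 → Plane → ℝ} {G : Fin 2 → Finset Plane → Plane}
  (h : IsSplit D 𝒯 v V G)

include h

lemma gradient_eq {m : Fin 2} {T : Finset Plane} (hT : T ∈ 𝒯.triangles) {x : Plane}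
    (hx : x ∈ D.sub m) (hxT : x ∈ interior (hull T)) : ∇ v x = G m T := by
  have hlin : HasGradientAt (fun y => V m x + ⟪G m T, y - x⟫) (G m T) x := by
    rw [hasGradientAt_iff_hasFDerivAt]
    have := ((InnerProductSpace.toDual ℝ Plane (G m T)).hasFDerivAt (x := x)).sub_const
      (InnerProductSpace.toDual ℝ Plane (G m T) x - V m x)
    refine this.congr_of_eventuallyEq (Eventually.of_forall fun y => ?_)
    simp only [InnerProductSpace.toDual_apply_apply, inner_sub_right]
    ring
  have hev : v =ᶠ[𝓝 x] fun y => V m x + ⟪G m T, y - x⟫ := by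
    filter_upwards [(D.sub_open m).mem_nhds hx, mem_interior_iff_mem_nhds.1 hxT] with y hy hyT
    rw [h.eqOn m hy, h.affine m T hT x (interior_subset hxT) y hyT]
  exact (hlin.congr_of_eventuallyEq hev).gradient

lemma trace_eq (m : Fin 2) {x : Plane} (hx : x ∈ D.Γ) : D.trace m v x = V m x := by
  have : (𝓝[D.sub m] x).NeBot := mem_closure_iff_nhdsWithin_neBot.1 (D.mem_closure_sub hx m)
  refine Tendsto.limUnder_eq ?_
  have h2 : Tendsto (V m) (𝓝[D.sub m] x) (𝓝 (V m x)) :=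
    (h.continuousOn m x (subset_closure hx.1)).mono_left
      (nhdsWithin_mono _ ((D.sub_subset m).trans subset_closure))
  exact h2.congr' ((h.eqOn m).symm.eventuallyEq_of_mem self_mem_nhdsWithin)

lemma jump_eq {x : Plane} (hx : x ∈ D.Γ) : D.jump v x = V 0 x - V 1 x := by
  rw [InterfaceDomain.jump, h.trace_eq 0 hx, h.trace_eq 1 hx]

lemma ae_gradient_eq (m : Fin 2) {T : Finset Plane} (hT : T ∈ 𝒯.triangles) :
    ∀ᵐ x ∂volume.restrict (hull T ∩ D.sub m), ∇ v x = G m T := by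
  filter_upwards [ae_mem_interior_hull T (D.sub m),
    ae_restrict_mem ((measurableSet_hull T).inter (D.measurableSet_sub m))] with x h1 h2
  exact h.gradient_eq hT h2.2 h1

lemma elementGrad_eq (m : Fin 2) {T : Finset Plane} (hT : T ∈ 𝒯.triangles)
    (hpos : volume.real (hull T ∩ D.sub m) ≠ 0) : elementGrad D m T v = G m T := by
  rw [elementGrad, integral_congr_ae (h.ae_gradient_eq m hT), setIntegral_const, smul_smul,
    inv_mul_cancel₀ hpos, one_smul]

lemma avgFlux_eq (α : Fin 2 → ℝ) {T : Finset Plane} (hT : T ∈ 𝒯.triangles) (ν : Plane) :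
    avgFlux D α T v ν = ∑ m, weight D m T * (α m * ⟪G m T, ν⟫) := by
  refine Finset.sum_congr rfl fun m _ => ?_
  by_cases hpos : volume.real (hull T ∩ D.sub m) = 0
  · simp [weight, hpos]
  · rw [h.elementGrad_eq m hT hpos]

lemma integral_gradient (α : Fin 2 → ℝ) (m : Fin 2) : ∫ x in D.sub m, α m * ⟪∇ v x, ∇ v x⟫ =
    ∑ T ∈ 𝒯.triangles, α m * (volume.real (hull T ∩ D.sub m) * ‖G m T‖ ^ 2) := by
  have hae : ∀ T ∈ 𝒯.triangles,
      (fun x => α m * ⟪∇ v x, ∇ v x⟫) =ᵐ[volume.restrict (hull T ∩ D.sub m)]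
      fun _ => α m * ‖G m T‖ ^ 2 := by
    intro T hT
    filter_upwards [h.ae_gradient_eq m hT] with x hx
    rw [hx, real_inner_self_eq_norm_sq]
  rw [D.restrict_sub 𝒯 m, integral_finsetSum_measure]
  · refine Finset.sum_congr rfl fun T hT => ?_
    rw [integral_congr_ae (hae T hT), setIntegral_const, smul_eq_mul]
    ring
  · intro T hT
    refine Integrable.congr ?_ (hae T hT).symm
    exact integrableOn_const (volume_inter_ne_top _ _)

lemma continuousOn_hull (m : Fin 2) {T : Finset Plane} (hT : T ∈ 𝒯.triangles) :
    ContinuousOn (V m) (hull T) := (h.continuousOn m).mono (𝒯.hull_subset_closure hT)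

lemma integrableOn_sq (m : Fin 2) {T : Finset Plane} (hT : T ∈ 𝒯.triangles) :
    IntegrableOn (fun x => V m x ^ 2) (hull T ∩ D.sub m) :=
  (((h.continuousOn_hull m hT).pow 2).integrableOn_compact (isCompact_hull T)).mono_set
    inter_subset_left

lemma normSq_eq : D.normSq v =
    ∑ m, ∑ T ∈ 𝒯.triangles, ∫ x in hull T ∩ D.sub m, V m x ^ 2 := by
  refine Finset.sum_congr rfl fun m _ => ?_
  rw [setIntegral_congr_fun (D.measurableSet_sub m) (g := fun x => V m x ^ 2)
    fun x hx => by simp only [h.eqOn m hx], D.restrict_sub 𝒯 m, integral_finsetSum_measure]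
  exact fun T hT => h.integrableOn_sq m hT

end IsSplit

/-! ### Integration along horizontal lines -/

/-- The point of the plane with coordinates `s` and `y`. -/
def pt (s y : ℝ) : Plane := !₂[s, y]

@[simp] lemma pt_zero (s y : ℝ) : pt s y 0 = s := rfl

@[simp] lemma pt_one (s y : ℝ) : pt s y 1 = y := rfl

lemma pt_eta (z : Plane) : pt (z 0) (z 1) = z := by
  ext i; fin_cases i <;> rfl

lemma pt_eq_add_smul (s u y : ℝ) : pt u y - pt s y = (u - s) • pt 1 0 := by
  ext i; fin_cases i <;> simp [pt]

lemma norm_pt_one_zero : ‖pt 1 0‖ = 1 := by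
  have : ‖pt 1 0‖ ^ 2 = 1 := by rw [norm_sq_plane]; simp
  exact (pow_eq_one_iff_of_nonneg (norm_nonneg _) two_ne_zero).1 this

lemma isometry_pt (y : ℝ) : Isometry fun s => pt s y := by
  refine Isometry.of_dist_eq fun u s => ?_
  rw [dist_eq_norm, pt_eq_add_smul, norm_smul, norm_pt_one_zero, mul_one, Real.dist_eq,
    Real.norm_eq_abs]

lemma measurePreserving_pt : MeasurePreserving (fun q : ℝ × ℝ => pt q.1 q.2) := by
  have h1 := (volume_preserving_finTwoArrow ℝ).symm
  exact (PiLp.volume_preserving_toLp (Fin 2)).comp h1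

lemma lintegral_plane {f : Plane → ENNReal} (hf : Measurable f) :
    ∫⁻ x, f x = ∫⁻ y, ∫⁻ s, f (pt s y) := by
  rw [← measurePreserving_pt.lintegral_comp hf, Measure.volume_eq_prod]
  exact lintegral_prod_symm' _ (hf.comp measurePreserving_pt.measurable)

lemma countable_frontier_of_isCompact_convex {J : Set ℝ} (hJ : IsCompact J) (hc : Convex ℝ J) :
    (frontier J).Countable := by
  rcases J.eq_empty_or_nonempty with rfl | hne
  · simp
  · rw [eq_Icc_of_connected_compact ⟨hne, hc.isPreconnected⟩ hJ, frontier_Icc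
      (csInf_le_csSup hne hJ.bddBelow hJ.bddAbove)]
    exact (Set.toFinite _).countable

lemma isCompact_line_hull (T : Finset Plane) (y : ℝ) : IsCompact {s | pt s y ∈ hull T} :=
  (isometry_pt y).isClosedEmbedding.isCompact_preimage (isCompact_hull T)

lemma convex_line {s : Set Plane} (hs : Convex ℝ s) (y : ℝ) : Convex ℝ {u | pt u y ∈ s} := by
  intro a ha b hb t t' ht ht' htt
  have : pt (t • a + t' • b) y = t • pt a y + t' • pt b y := by
    ext i
    fin_cases i
    · simp [pt]
    · simp only [pt, Fin.mk_one, PiLp.add_apply, PiLp.smul_apply]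
      simp [← add_mul, htt]
  show pt (t • a + t' • b) y ∈ s
  rw [this]
  exact hs ha hb ht ht' htt

lemma exists_eq_Ioo_of_isOpen_convex {I : Set ℝ} (hI : IsOpen I) (hc : Convex ℝ I)
    (hb : Bornology.IsBounded I) (hne : I.Nonempty) : ∃ l r, l < r ∧ I = Ioo l r := by
  have hI' : I = Ioo (sInf I) (sSup I) := by
    ext s
    constructor
    · intro hs
      obtain ⟨a, b, ⟨has, hsb⟩, hab⟩ := mem_nhds_iff_exists_Ioo_subset.1 (hI.mem_nhds hs)
      obtain ⟨c, hc1, hc2⟩ := exists_between has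
      obtain ⟨c', hc1', hc2'⟩ := exists_between hsb
      exact ⟨(csInf_le hb.bddBelow (hab ⟨hc1, hc2.trans hsb⟩)).trans_lt hc2,
        hc1'.trans_le (le_csSup hb.bddAbove (hab ⟨has.trans hc1', hc2'⟩))⟩
    · rintro ⟨h1, h2⟩
      obtain ⟨a, ha, has⟩ := exists_lt_of_csInf_lt hne h1
      obtain ⟨b, hb, hsb⟩ := exists_lt_of_lt_csSup hne h2
      exact hc.ordConnected.out ha hb ⟨has.le, hsb.le⟩
  obtain ⟨s, hs⟩ := hne
  rw [hI'] at hs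
  exact ⟨_, _, hs.1.trans hs.2, hI'⟩

/-- The bound `2 |v| |∇ v|` for the gradient of `v²` on `Ω₁ ∪ Ω₂`. -/
def sqGradBound (D : InterfaceDomain) (𝒯 : Triangulation D.Ω) (V : Fin 2 → Plane → ℝ)
    (G : Fin 2 → Finset Plane → Plane) (x : Plane) : ENNReal :=
  ∑ m, ∑ T ∈ 𝒯.triangles,
    (hull T ∩ D.sub m).indicator (fun x => ENNReal.ofReal (2 * |V m x| * ‖G m T‖)) x

namespace IsSplit

variable {v : Plane → ℝ} {V : Fin 2 → Plane → ℝ} {G : Fin 2 → Finset Plane → Plane}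
  (h : IsSplit D 𝒯 v V G)

include h

lemma measurable_indicator (m : Fin 2) {s : Set Plane} (hs : MeasurableSet s)
    (hsub : s ⊆ closure D.Ω) {f : ℝ → ENNReal} (hf : Continuous f) :
    Measurable (s.indicator fun x => f (V m x)) := by
  classical
  rw [← piecewise_eq_indicator]
  exact (hf.comp_continuousOn ((h.continuousOn m).mono hsub)).measurable_piecewise
    continuousOn_const hs

lemma measurable_sqGradBound : Measurable (sqGradBound D 𝒯 V G) := by
  refine Finset.measurable_fun_sum _ fun m _ => Finset.measurable_fun_sum _ fun T hT => ?_
  refine h.measurable_indicator m ((measurableSet_hull T).inter (D.measurableSet_sub m))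
    (inter_subset_left.trans (𝒯.hull_subset_closure hT))
    (f := fun t => ENNReal.ofReal (2 * |t| * ‖G m T‖)) ?_
  exact ENNReal.continuous_ofReal.comp (by fun_prop)

lemma hasDerivAt_line (m : Fin 2) {T : Finset Plane} (hT : T ∈ 𝒯.triangles) {s y : ℝ}
    (hs : s ∈ interior {u | pt u y ∈ hull T}) :
    HasDerivAt (fun u => V m (pt u y)) ⟪G m T, pt 1 0⟫ s := by
  have h1 : HasDerivAt (fun u => V m (pt s y) + (u - s) * ⟪G m T, pt 1 0⟫) ⟪G m T, pt 1 0⟫ s := by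
    simpa using (((hasDerivAt_id s).sub_const s).mul_const ⟪G m T, pt 1 0⟫).const_add
      (V m (pt s y))
  refine h1.congr_of_eventuallyEq ?_
  filter_upwards [mem_interior_iff_mem_nhds.1 hs] with u hu
  have hs' : pt s y ∈ hull T := interior_subset (s := {u | pt u y ∈ hull T}) hs
  rw [h.affine m T hT _ hs' _ hu, pt_eq_add_smul, inner_smul_right]

lemma sq_le_along_line {y : ℝ} (hfin : {z ∈ D.Γ | z 1 = y}.Finite) {S : ENNReal}
    (hS : ∀ F : Finset Plane, (F : Set Plane) ⊆ D.Γ → (∀ z ∈ F, z 1 = y) →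
      ∑ z ∈ F, ENNReal.ofReal |V 0 z ^ 2 - V 1 z ^ 2| ≤ S) (m : Fin 2) {s₀ : ℝ}
    (hs₀ : pt s₀ y ∈ D.sub m) :
    ENNReal.ofReal (V m (pt s₀ y) ^ 2) ≤ (∫⁻ s, sqGradBound D 𝒯 V G (pt s y)) + S := by
  have hpt : Continuous fun s => pt s y := (isometry_pt y).continuous
  by_cases htop : ∫⁻ s, sqGradBound D 𝒯 V G (pt s y) = ⊤
  · simp [htop]
  set d : ℝ → ENNReal := fun s => sqGradBound D 𝒯 V G (pt s y) with hd
  have hdtop : ∀ A : Set ℝ, ∫⁻ s in A, d s ≠ ⊤ := fun A =>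
    ne_top_of_le_ne_top htop (setLIntegral_le_lintegral A d)
  set Φ : ℝ → ℝ := fun s => (∫⁻ u in Iic s, d u).toReal with hΦdef
  have hΦ : Monotone Φ := fun a b hab =>
    ENNReal.toReal_mono (hdtop _) (lintegral_mono_set (Iic_subset_Iic.2 hab))
  have hΦdiff : ∀ a b, a ≤ b → (∫⁻ u in Ioc a b, d u).toReal = Φ b - Φ a := by
    intro a b hab
    have : ∫⁻ u in Iic b, d u = (∫⁻ u in Iic a, d u) + ∫⁻ u in Ioc a b, d u := by
      rw [← Iic_union_Ioc_eq_Iic hab, lintegral_union measurableSet_Ioc]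
      exact Set.disjoint_left.2 fun u hu hu' => absurd hu'.1 (not_lt.2 hu)
    simp only [hΦdef, this, ENNReal.toReal_add (hdtop _) (hdtop _)]
    ring
  obtain ⟨l, r, hlr, hI⟩ := exists_eq_Ioo_of_isOpen_convex (D.isOpen_Ω.preimage hpt)
    (convex_line D.convex_Ω y) ((isometry_pt y).antilipschitz.isBounded_preimage D.isBounded_Ω)
    ⟨s₀, D.sub_subset m hs₀⟩
  have hIm : ∀ s, pt s y ∈ D.Ω ↔ s ∈ Ioo l r := fun s => by rw [← hI]; rfl
  have hIcl : ∀ s ∈ Icc l r, pt s y ∈ closure D.Ω := by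
    intro s hs
    rw [← closure_Ioo hlr.ne, ← hI] at hs
    exact (hpt.closure_preimage_subset D.Ω) hs
  set F : Finset ℝ := hfin.toFinset.image fun z => z 0 with hF
  have hFmem : ∀ s, s ∈ F ↔ pt s y ∈ D.Γ := by
    intro s
    simp only [hF, Finset.mem_image, Set.Finite.mem_toFinset]
    constructor
    · rintro ⟨z, ⟨hz, rfl⟩, rfl⟩
      rwa [pt_eta]
    · exact fun hs => ⟨_, ⟨hs, rfl⟩, rfl⟩
  have key := le_add_sum_crossings (l := l) (r := r) (S := fun m => {s | pt s y ∈ D.sub m})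
    (F := F) (w := fun m s => V m (pt s y) ^ 2) (Φ := Φ) ?_
    (fun m => (D.sub_open m).preimage hpt)
    (Set.disjoint_left.2 fun s hs hs' => Set.disjoint_left.1 D.sub_disjoint hs hs') ?_
    (fun s => ENNReal.toReal_nonneg) hΦ
    (fun m => ((h.continuousOn m).comp hpt.continuousOn hIcl).pow 2) ?_ ?_ m s₀
    ((hIm s₀).1 (D.sub_subset m hs₀)) hs₀
  · have hsum : ENNReal.ofReal (∑ z ∈ F with l < z ∧ z < s₀,
        |V 0 (pt z y) ^ 2 - V 1 (pt z y) ^ 2|) ≤ S := by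
      rw [ENNReal.ofReal_sum_of_nonneg fun _ _ => abs_nonneg _]
      have := hS ((F.filter fun z => l < z ∧ z < s₀).image fun s => pt s y) ?_ ?_
      · rwa [Finset.sum_image fun a _ b _ hab => (isometry_pt y).injective hab] at this
      · intro z hz
        obtain ⟨s, hs, rfl⟩ := Finset.mem_image.1 (Finset.mem_coe.1 hz)
        exact (hFmem s).1 (Finset.mem_filter.1 hs).1
      · intro z hz
        obtain ⟨s, hs, rfl⟩ := Finset.mem_image.1 hz
        rfl
    refine (ENNReal.ofReal_le_ofReal key).trans (ENNReal.ofReal_add_le.trans ?_)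
    refine add_le_add ?_ hsum
    rw [ENNReal.ofReal_toReal (hdtop _)]
    exact setLIntegral_le_lintegral _ _
  · intro s hs
    rcases D.mem_Γ_or _ ((hIm s).2 hs) with h1 | ⟨m', h1⟩
    · exact Or.inl ((hFmem s).2 h1)
    · refine Or.inr ?_
      fin_cases m'
      exacts [Or.inl h1, Or.inr h1]
  · intro m' s hs hs'
    have := ((hFmem s).1 hs).2
    fin_cases m'
    exacts [this (Or.inl hs'), this (Or.inr hs')]
  · intro m' b hb hsub
    have hl1 : pt l y ∈ closure (D.sub m') := by
      have : l ∈ closure (Ioc l b) := by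
        rw [closure_Ioc hb.1.ne]; exact left_mem_Icc.2 hb.1.le
      exact hpt.closure_preimage_subset _ (closure_mono hsub this)
    have hl2 : pt l y ∈ frontier D.Ω := by
      rw [D.isOpen_Ω.frontier_eq]
      exact ⟨hIcl l (left_mem_Icc.2 hlr.le), fun hl => lt_irrefl _ ((hIm l).1 hl).1⟩
    simp [h.boundary m' _ hl2 hl1]
  · intro m' a b hla hab hbr hsub
    rw [← hΦdiff a b hab]
    have hE : (⋃ T ∈ 𝒯.triangles, frontier {s | pt s y ∈ hull T}).Countable :=
      (Finset.countable_toSet _).biUnion fun T _ =>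
        countable_frontier_of_isCompact_convex (isCompact_line_hull T y)
          (convex_line (convex_hull T) y)
    have hint : ∀ s ∈ Ioo a b \ ⋃ T ∈ 𝒯.triangles, frontier {s | pt s y ∈ hull T},
        ∃ T ∈ 𝒯.triangles, s ∈ interior {s | pt s y ∈ hull T} := by
      rintro s ⟨hs, hsE⟩
      have h1 : pt s y ∈ closure D.Ω :=
        hIcl s ⟨(hla.trans hs.1).le, (hs.2.trans hbr).le⟩
      have h2 := 𝒯.closure_subset_iUnion_hull D.isOpen_Ω h1
      simp only [mem_iUnion, not_exists] at h2 hsE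
      obtain ⟨T, hT, hsT⟩ := h2
      refine ⟨T, hT, ?_⟩
      by_contra hni
      exact hsE T hT ⟨subset_closure hsT, hni⟩
    have hbd : ∀ T, |⟪G m' T, pt 1 0⟫| ≤ ‖G m' T‖ := fun T => by
      simpa [norm_pt_one_zero] using abs_real_inner_le_norm (G m' T) (pt 1 0)
    have := sq_sub_sq_le_lintegral (f := fun s => V m' (pt s y)) (M := ∑ T ∈ 𝒯.triangles, ‖G m' T‖)
      (d := d) hab (((h.continuousOn m').comp hpt.continuousOn hIcl).mono
        (Icc_subset_Icc hla.le hbr.le)) hE ?_ ?_ (hdtop _)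
    · linarith
    · intro s hs
      obtain ⟨T, hT, hsT⟩ := hint s hs
      have hder := h.hasDerivAt_line m' hT hsT
      refine ⟨hder.differentiableAt, ?_⟩
      rw [hder.deriv]
      exact (hbd T).trans (Finset.single_le_sum (f := fun T => ‖G m' T‖)
        (fun _ _ => norm_nonneg _) hT)
    · filter_upwards [hE.ae_notMem volume] with s hsE hs
      obtain ⟨T, hT, hsT⟩ := hint s ⟨hs, hsE⟩
      rw [(h.hasDerivAt_line m' hT hsT).deriv]
      have hmem : pt s y ∈ hull T ∩ D.sub m' :=
        ⟨interior_subset (s := {s | pt s y ∈ hull T}) hsT, hsub ⟨hs.1.le, hs.2.le⟩⟩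
      calc ENNReal.ofReal (2 * |V m' (pt s y)| * |⟪G m' T, pt 1 0⟫|)
          ≤ ENNReal.ofReal (2 * |V m' (pt s y)| * ‖G m' T‖) :=
            ENNReal.ofReal_le_ofReal (by gcongr; exact hbd T)
        _ = (hull T ∩ D.sub m').indicator
              (fun x => ENNReal.ofReal (2 * |V m' x| * ‖G m' T‖)) (pt s y) := by
            rw [indicator_of_mem hmem]
        _ ≤ ∑ T ∈ 𝒯.triangles, (hull T ∩ D.sub m').indicator
              (fun x => ENNReal.ofReal (2 * |V m' x| * ‖G m' T‖)) (pt s y) :=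
            Finset.single_le_sum (f := fun T => (hull T ∩ D.sub m').indicator
              (fun x => ENNReal.ofReal (2 * |V m' x| * ‖G m' T‖)) (pt s y))
              (fun _ _ => zero_le) hT
        _ ≤ d s :=
            Finset.single_le_sum (f := fun m => ∑ T ∈ 𝒯.triangles, (hull T ∩ D.sub m).indicator
              (fun x => ENNReal.ofReal (2 * |V m x| * ‖G m T‖)) (pt s y))
              (fun _ _ => zero_le) (Finset.mem_univ m')

lemma lintegral_sq_le : ∑ m, ∫⁻ x in D.sub m, ENNReal.ofReal (V m x ^ 2) ≤
    ENNReal.ofReal (Metric.diam D.Ω) * ((∫⁻ x, sqGradBound D 𝒯 V G x) +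
      ∫⁻ x in D.Γ, ENNReal.ofReal |V 0 x ^ 2 - V 1 x ^ 2| ∂(Measure.hausdorffMeasure 1)) := by
  have hg : ContinuousOn (fun x => ENNReal.ofReal |V 0 x ^ 2 - V 1 x ^ 2|) D.Γ :=
    ENNReal.continuous_ofReal.comp_continuousOn
      ((((h.continuousOn 0).pow 2).sub ((h.continuousOn 1).pow 2)).abs.mono
        (D.Γ_subset.trans subset_closure))
  obtain ⟨S, hSm, hS, hSint⟩ := exists_crossing_majorant D.measurableSet_Γ hg
  set u : Plane → ENNReal := fun x =>
    ∑ m, (D.sub m).indicator (fun x => ENNReal.ofReal (V m x ^ 2)) x with hu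
  have hum : ∀ m, Measurable ((D.sub m).indicator fun x => ENNReal.ofReal (V m x ^ 2)) := fun m =>
    h.measurable_indicator m (D.measurableSet_sub m) ((D.sub_subset m).trans subset_closure)
      (f := fun t => ENNReal.ofReal (t ^ 2)) (ENNReal.continuous_ofReal.comp (by fun_prop))
  have hline : ∀ᵐ y : ℝ, ∫⁻ s, u (pt s y) ≤ ENNReal.ofReal (Metric.diam D.Ω) *
      ((∫⁻ s, sqGradBound D 𝒯 V G (pt s y)) + S y) := by
    filter_upwards [ae_finite_crossings D.measurableSet_Γ D.hausdorffMeasure_Γ_lt_top.ne] with y hy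
    set R := (∫⁻ s, sqGradBound D 𝒯 V G (pt s y)) + S y with hR
    have hpt : Continuous fun s => pt s y := (isometry_pt y).continuous
    have hIm : MeasurableSet {s | pt s y ∈ D.Ω} := (D.isOpen_Ω.preimage hpt).measurableSet
    have hle : ∀ s, u (pt s y) ≤ {s | pt s y ∈ D.Ω}.indicator (fun _ => R) s := by
      intro s
      by_cases hs : ∃ m, pt s y ∈ D.sub m
      · obtain ⟨m, hm⟩ := hs
        rw [indicator_of_mem (show s ∈ {s | pt s y ∈ D.Ω} from D.sub_subset m hm), hu]
        simp only
        rw [Finset.sum_eq_single m, indicator_of_mem hm]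
        · exact h.sq_le_along_line hy (hS y) m hm
        · intro m' _ hne
          exact indicator_of_notMem (Set.disjoint_left.1 (D.disjoint_sub hne.symm) hm) _
        · simp
      · push Not at hs
        refine le_trans (le_of_eq ?_) zero_le
        exact Finset.sum_eq_zero fun m _ => indicator_of_notMem (hs m) _
    have hvol : volume {s | pt s y ∈ D.Ω} ≤ ENNReal.ofReal (Metric.diam D.Ω) := by
      refine (Real.volume_le_diam _).trans ?_
      rw [Metric.diam, ENNReal.ofReal_toReal D.isBounded_Ω.ediam_ne_top,
        ← (isometry_pt y).ediam_image]
      refine Metric.ediam_mono ?_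
      rintro _ ⟨s, hs, rfl⟩
      exact hs
    calc ∫⁻ s, u (pt s y) ≤ ∫⁻ s, {s | pt s y ∈ D.Ω}.indicator (fun _ => R) s := lintegral_mono hle
      _ = R * volume {s | pt s y ∈ D.Ω} := lintegral_indicator_const hIm R
      _ ≤ _ := by rw [mul_comm]; gcongr
  calc ∑ m, ∫⁻ x in D.sub m, ENNReal.ofReal (V m x ^ 2)
      = ∫⁻ x, u x := by
        rw [hu, lintegral_finsetSum _ fun m _ => hum m]
        exact Finset.sum_congr rfl fun m _ => (lintegral_indicator (D.measurableSet_sub m) _).symm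
    _ = ∫⁻ y, ∫⁻ s, u (pt s y) := lintegral_plane (Finset.measurable_fun_sum _ fun m _ => hum m)
    _ ≤ ∫⁻ y, ENNReal.ofReal (Metric.diam D.Ω) *
          ((∫⁻ s, sqGradBound D 𝒯 V G (pt s y)) + S y) := lintegral_mono_ae hline
    _ = ENNReal.ofReal (Metric.diam D.Ω) *
          ((∫⁻ y, ∫⁻ s, sqGradBound D 𝒯 V G (pt s y)) + ∫⁻ y, S y) := by
        rw [lintegral_const_mul' _ _ ENNReal.ofReal_ne_top, lintegral_add_right _ hSm]
    _ ≤ _ := by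
        rw [← lintegral_plane h.measurable_sqGradBound]
        gcongr

end IsSplit

/-! ### Integrals over the interface -/

namespace InterfaceDomain

variable (D)

lemma isCompact_closure_Ω : IsCompact (closure D.Ω) := D.isBounded_Ω.isCompact_closure

lemma integrableOn_Γ {f : Plane → ℝ} (hf : ContinuousOn f (closure D.Ω)) :
    IntegrableOn f D.Γ (Measure.hausdorffMeasure 1) := by
  obtain ⟨B, hB⟩ := D.isCompact_closure_Ω.exists_bound_of_continuousOn hf
  have hsub : D.Γ ⊆ closure D.Ω := D.Γ_subset.trans subset_closure
  have : IsFiniteMeasure ((Measure.hausdorffMeasure 1).restrict D.Γ) :=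
    ⟨by rw [Measure.restrict_apply_univ]; exact D.hausdorffMeasure_Γ_lt_top⟩
  refine Integrable.of_bound (C := B) ((hf.mono hsub).aestronglyMeasurable D.measurableSet_Γ) ?_
  filter_upwards [ae_restrict_mem D.measurableSet_Γ] with x hx using hB x (hsub hx)

end InterfaceDomain

lemma hausdorffMeasure_Γ_inter_hull_le {L : ℝ} (hL0 : 0 < L)
    (hL : ∀ (x : Plane) (r : ℝ), 0 ≤ r →
      Measure.hausdorffMeasure 1 (D.Γ ∩ Metric.closedBall x r) ≤ ENNReal.ofReal (L * r))
    {T : Finset Plane} (hT : T ∈ 𝒯.triangles) :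
    (Measure.hausdorffMeasure 1 : Measure Plane).real (D.Γ ∩ hull T) ≤ L * 𝒯.meshSize := by
  obtain ⟨x, hx⟩ := 𝒯.interior_hull_nonempty hT
  have hpos : 0 ≤ 𝒯.meshSize := (𝒯.hT_pos hT).le.trans (𝒯.hT_le_meshSize hT)
  refine ENNReal.toReal_le_of_le_ofReal (by positivity) (le_trans (measure_mono ?_) (hL x _ hpos))
  exact inter_subset_inter_right _ fun y hy =>
    (dist_le_hT hy (interior_subset hx)).trans (𝒯.hT_le_meshSize hT)

lemma hausdorffMeasure_Γ_inter_ne_top (T : Finset Plane) :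
    (Measure.hausdorffMeasure 1 : Measure Plane) (D.Γ ∩ hull T) ≠ ⊤ :=
  measure_ne_top_of_subset inter_subset_left D.hausdorffMeasure_Γ_lt_top.ne

lemma sum_integral_Γ_inter_hull_le {K : ℝ} (hK0 : 0 ≤ K)
    (hK : ∀ T ∈ 𝒯.triangles, 𝒯.meshSize ^ 2 ≤ K * volume.real (hull T)) {f : Plane → ℝ}
    (hf : ContinuousOn f (closure D.Ω)) (hf0 : ∀ x, 0 ≤ f x) :
    ∑ T ∈ 𝒯.triangles, ∫ x in D.Γ ∩ hull T, f x ∂(Measure.hausdorffMeasure 1) ≤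
      4 * K * ∫ x in D.Γ, f x ∂(Measure.hausdorffMeasure 1) := by
  have hint := D.integrableOn_Γ hf
  calc ∑ T ∈ 𝒯.triangles, ∫ x in D.Γ ∩ hull T, f x ∂(Measure.hausdorffMeasure 1)
      = ∑ T ∈ 𝒯.triangles, ∫ x in D.Γ, (hull T).indicator f x ∂(Measure.hausdorffMeasure 1) :=
        Finset.sum_congr rfl fun T _ => (setIntegral_indicator (measurableSet_hull T)).symm
    _ = ∫ x in D.Γ, ∑ T ∈ 𝒯.triangles, (hull T).indicator f x ∂(Measure.hausdorffMeasure 1) :=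
        (integral_finsetSum _ fun T _ => hint.indicator (measurableSet_hull T)).symm
    _ ≤ ∫ x in D.Γ, 4 * K * f x ∂(Measure.hausdorffMeasure 1) := by
        refine integral_mono (integrable_finsetSum _ fun T _ =>
          hint.indicator (measurableSet_hull T)) (hint.const_mul _) fun x => ?_
        classical
        simp only [indicator_apply]
        rw [← Finset.sum_filter, Finset.sum_const, nsmul_eq_mul]
        exact mul_le_mul_of_nonneg_right (𝒯.card_le_of_mem D.isOpen_Ω D.nonempty hK hK0 x
          (Finset.filter_subset _ _) fun T hT => (Finset.mem_filter.1 hT).2) (hf0 x)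
    _ = _ := integral_const_mul _ _

lemma sum_volume_sub (T : Finset Plane) (hT : T ∈ 𝒯.triangles) :
    ∑ m, volume.real (hull T ∩ D.sub m) = volume.real (hull T) := by
  have hΓ : volume (D.Γ) = 0 := by
    have h0 : ∫⁻ x, D.Γ.indicator (fun _ => (1 : ENNReal)) x = 0 := by
      rw [lintegral_plane (measurable_const.indicator D.measurableSet_Γ)]
      refine (lintegral_congr_ae ?_).trans lintegral_zero
      filter_upwards [ae_finite_crossings D.measurableSet_Γ D.hausdorffMeasure_Γ_lt_top.ne]
        with y hy
      refine (lintegral_congr_ae ?_).trans lintegral_zero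
      have hc : {s | pt s y ∈ D.Γ}.Countable := by
        refine (hy.image fun z => z 0).countable.mono fun s hs => ?_
        exact ⟨pt s y, ⟨hs, rfl⟩, rfl⟩
      filter_upwards [hc.ae_notMem volume] with s hs
      exact indicator_of_notMem hs _
    rwa [lintegral_indicator D.measurableSet_Γ, setLIntegral_one] at h0
  have hnull : volume (hull T \ (D.sub 0 ∪ D.sub 1)) = 0 := by
    refine measure_mono_null (t := D.Γ ∪ frontier D.Ω) ?_
      (measure_union_null hΓ (D.convex_Ω.addHaar_frontier volume))
    rintro x ⟨hx, hxs⟩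
    by_cases hxΩ : x ∈ D.Ω
    · exact Or.inl ⟨hxΩ, hxs⟩
    · rw [D.isOpen_Ω.frontier_eq]
      exact Or.inr ⟨𝒯.hull_subset_closure hT hx, hxΩ⟩
  rw [Fin.sum_univ_two, ← measureReal_union ((D.sub_disjoint.mono inter_subset_right
    inter_subset_right)) ((measurableSet_hull T).inter (D.measurableSet_sub 1))
    (volume_inter_ne_top _ _) (volume_inter_ne_top _ _), ← inter_union_distrib_left]
  have h1 := measure_inter_add_sdiff (μ := volume) (hull T)
    ((D.measurableSet_sub 0).union (D.measurableSet_sub 1))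
  rw [hnull, add_zero] at h1
  rw [measureReal_def, h1, measureReal_def]

lemma weight_nonneg (m : Fin 2) (T : Finset Plane) : 0 ≤ weight D m T :=
  div_nonneg measureReal_nonneg measureReal_nonneg

lemma weight_le_one (m : Fin 2) (T : Finset Plane) : weight D m T ≤ 1 :=
  div_le_one_of_le₀ (measureReal_mono inter_subset_left (volume_hull_ne_top T)) measureReal_nonneg

namespace IsSplit

variable {v : Plane → ℝ} {V : Fin 2 → Plane → ℝ} {G : Fin 2 → Finset Plane → Plane}
  (h : IsSplit D 𝒯 v V G)

include h

lemma continuousOn_jump_sq : ContinuousOn (fun x => (V 0 x - V 1 x) ^ 2) (closure D.Ω) :=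
  ((h.continuousOn 0).sub (h.continuousOn 1)).pow 2

lemma abs_avgFlux_le {α : Fin 2 → ℝ} (hα : ∀ m, 0 < α m) {T : Finset Plane}
    (hT : T ∈ 𝒯.triangles) {ν : Plane} (hν : ‖ν‖ ≤ 1) :
    |avgFlux D α T v ν| ≤ ∑ m, weight D m T * (α m * ‖G m T‖) := by
  rw [h.avgFlux_eq α hT]
  refine (Finset.abs_sum_le_sum_abs _ _).trans (Finset.sum_le_sum fun m _ => ?_)
  rw [abs_mul, abs_mul, abs_of_nonneg (weight_nonneg m T), abs_of_pos (hα m)]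
  have := hα m
  have := weight_nonneg (D := D) m T
  gcongr
  exact (abs_real_inner_le_norm _ _).trans (mul_le_of_le_one_right (norm_nonneg _) hν)

lemma two_mul_abs_flux_le {α : Fin 2 → ℝ} (hα : ∀ m, 0 < α m) {K L : ℝ} (hK0 : 0 < K) (hL0 : 0 < L)
    (hK : ∀ T ∈ 𝒯.triangles, 𝒯.meshSize ^ 2 ≤ K * volume.real (hull T))
    (hL : ∀ T ∈ 𝒯.triangles,
      (Measure.hausdorffMeasure 1 : Measure Plane).real (D.Γ ∩ hull T) ≤ L * 𝒯.meshSize)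
    {n : Plane → Plane} (hn : ∀ x ∈ D.Γ, ‖n x‖ ≤ 1) {T : Finset Plane} (hT : T ∈ 𝒯.triangles) :
    2 * |∫ x in D.Γ ∩ hull T, avgFlux D α T v (n x) * D.jump v x ∂(Measure.hausdorffMeasure 1)| ≤
      1 / 2 * ∑ m, α m * (volume.real (hull T ∩ D.sub m) * ‖G m T‖ ^ 2) +
      4 * L * K * max (α 0) (α 1) * 𝒯.meshSize⁻¹ *
        ∫ x in D.Γ ∩ hull T, (V 0 x - V 1 x) ^ 2 ∂(Measure.hausdorffMeasure 1) := by
  set μ : Measure Plane := Measure.hausdorffMeasure 1 with hμ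
  set H := 𝒯.meshSize with hH
  set a := max (α 0) (α 1) with ha
  have hHpos : 0 < H := 𝒯.meshSize_pos D.isOpen_Ω D.nonempty
  have hapos : 0 < a := lt_max_of_lt_left (hα 0)
  have hαa : ∀ m, α m ≤ a := by
    intro m
    fin_cases m
    exacts [le_max_left _ _, le_max_right _ _]
  set B := ∑ m, weight D m T * (α m * ‖G m T‖) with hB
  have hB0 : 0 ≤ B := Finset.sum_nonneg fun m _ =>
    mul_nonneg (weight_nonneg m T) (mul_nonneg (hα m).le (norm_nonneg _))
  set δ := (4 * L * K * a)⁻¹ with hδ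
  have hδpos : 0 < δ := by positivity
  have hint : IntegrableOn (fun x => (V 0 x - V 1 x) ^ 2) (D.Γ ∩ hull T) μ :=
    (D.integrableOn_Γ h.continuousOn_jump_sq).mono_set inter_subset_left
  have hΓT : MeasurableSet (D.Γ ∩ hull T) := D.measurableSet_Γ.inter (measurableSet_hull T)
  have hpt : ∀ x ∈ D.Γ ∩ hull T, ‖avgFlux D α T v (n x) * D.jump v x‖ ≤
      δ * H * B ^ 2 / 2 + (δ * H)⁻¹ / 2 * (V 0 x - V 1 x) ^ 2 := by
    intro x hx
    rw [h.jump_eq hx.1, Real.norm_eq_abs, abs_mul, ← sq_abs (V 0 x - V 1 x)]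
    have h1 := h.abs_avgFlux_le hα hT (hn x hx.1)
    refine (mul_le_mul_of_nonneg_right h1 (abs_nonneg _)).trans ?_
    set j := |V 0 x - V 1 x|
    have e : δ * H * B ^ 2 / 2 + (δ * H)⁻¹ / 2 * j ^ 2 - B * j
        = (δ * H)⁻¹ / 2 * (δ * H * B - j) ^ 2 := by
      field_simp
      ring
    have : 0 ≤ (δ * H)⁻¹ / 2 * (δ * H * B - j) ^ 2 := by positivity
    linarith
  have hconst : Integrable (fun _ => δ * H * B ^ 2 / 2) (μ.restrict (D.Γ ∩ hull T)) :=
    integrableOn_const (hausdorffMeasure_Γ_inter_ne_top T)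
  have hsq : Integrable (fun x => (δ * H)⁻¹ / 2 * (V 0 x - V 1 x) ^ 2)
      (μ.restrict (D.Γ ∩ hull T)) := hint.const_mul _
  have h1 := norm_integral_le_of_norm_le (μ := μ.restrict (D.Γ ∩ hull T))
    (f := fun x => avgFlux D α T v (n x) * D.jump v x)
    (g := fun x => δ * H * B ^ 2 / 2 + (δ * H)⁻¹ / 2 * (V 0 x - V 1 x) ^ 2)
    (hconst.add hsq)
    ((ae_restrict_iff' hΓT).2 (Eventually.of_forall hpt))
  rw [integral_add hconst hsq, setIntegral_const, integral_const_mul, Real.norm_eq_abs,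
    smul_eq_mul] at h1
  have hBsq : H ^ 2 * B ^ 2 ≤
      2 * a * K * ∑ m, α m * (volume.real (hull T ∩ D.sub m) * ‖G m T‖ ^ 2) := by
    have hm : ∀ m, H ^ 2 * (weight D m T * (α m * ‖G m T‖)) ^ 2 ≤
        a * K * (α m * (volume.real (hull T ∩ D.sub m) * ‖G m T‖ ^ 2)) := by
      intro m
      have hw0 := weight_nonneg (D := D) m T
      have hw1 := weight_le_one (D := D) m T
      have hαm := hα m
      have hvol : H ^ 2 * weight D m T ≤ K * volume.real (hull T ∩ D.sub m) := by
        have := mul_le_mul_of_nonneg_right (hK T hT) hw0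
        rwa [mul_assoc, weight, mul_div_cancel₀ _ (𝒯.volume_real_hull_pos hT).ne'] at this
      calc H ^ 2 * (weight D m T * (α m * ‖G m T‖)) ^ 2
          = (H ^ 2 * weight D m T) * weight D m T * α m * (α m * ‖G m T‖ ^ 2) := by ring
        _ ≤ (K * volume.real (hull T ∩ D.sub m)) * 1 * a * (α m * ‖G m T‖ ^ 2) := by
            gcongr
            exact hαa m
        _ = _ := by ring
    have h0 := hm 0
    have h1 := hm 1
    rw [hB, Fin.sum_univ_two, Fin.sum_univ_two]
    nlinarith [sq_nonneg (weight D 0 T * (α 0 * ‖G 0 T‖) - weight D 1 T * (α 1 * ‖G 1 T‖)),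
      sq_nonneg H, mul_nonneg (sq_nonneg H)
      (sq_nonneg (weight D 0 T * (α 0 * ‖G 0 T‖) - weight D 1 T * (α 1 * ‖G 1 T‖)))]
  have h2 : μ.real (D.Γ ∩ hull T) * (δ * H * B ^ 2 / 2) ≤
      1 / 4 * ∑ m, α m * (volume.real (hull T ∩ D.sub m) * ‖G m T‖ ^ 2) := by
    calc μ.real (D.Γ ∩ hull T) * (δ * H * B ^ 2 / 2) ≤ L * H * (δ * H * B ^ 2 / 2) := by
          gcongr
          exact hL T hT
      _ = L * δ / 2 * (H ^ 2 * B ^ 2) := by ring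
      _ ≤ L * δ / 2 *
          (2 * a * K * ∑ m, α m * (volume.real (hull T ∩ D.sub m) * ‖G m T‖ ^ 2)) := by gcongr
      _ = _ := by
          rw [hδ]
          field_simp
  have h3 : (δ * H)⁻¹ = 4 * L * K * a * H⁻¹ := by rw [hδ, mul_inv, inv_inv]
  rw [h3] at h1
  linarith

/-- Coercivity of the bilinear form with respect to the broken energy norm. -/
lemma energy_le_nitscheForm {α : Fin 2 → ℝ} (hα : ∀ m, 0 < α m) {K L : ℝ} (hK0 : 0 < K)
    (hL0 : 0 < L) (hK : ∀ T ∈ 𝒯.triangles, 𝒯.meshSize ^ 2 ≤ K * volume.real (hull T))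
    (hL : ∀ T ∈ 𝒯.triangles,
      (Measure.hausdorffMeasure 1 : Measure Plane).real (D.Γ ∩ hull T) ≤ L * 𝒯.meshSize)
    {n : Plane → Plane} (hn : ∀ x ∈ D.Γ, ‖n x‖ ≤ 1) {C : ℝ} (hC : 16 * L * K ^ 2 + 1 ≤ C) :
    1 / 2 * ∑ m, ∑ T ∈ 𝒯.triangles, α m * (volume.real (hull T ∩ D.sub m) * ‖G m T‖ ^ 2) +
      max (α 0) (α 1) * 𝒯.meshSize⁻¹ *
        ∫ x in D.Γ, (V 0 x - V 1 x) ^ 2 ∂(Measure.hausdorffMeasure 1) ≤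
      nitscheForm D 𝒯 α C n v v := by
  set μ : Measure Plane := Measure.hausdorffMeasure 1 with hμ
  set H := 𝒯.meshSize with hH
  set a := max (α 0) (α 1) with ha
  have hHpos : 0 < H := 𝒯.meshSize_pos D.isOpen_Ω D.nonempty
  have hapos : 0 < a := lt_max_of_lt_left (hα 0)
  set J := ∫ x in D.Γ, (V 0 x - V 1 x) ^ 2 ∂μ with hJ
  have hJ0 : 0 ≤ J := integral_nonneg fun x => sq_nonneg _
  have hjump : ∫ x in D.Γ, D.jump v x * D.jump v x ∂μ = J := by
    refine setIntegral_congr_fun D.measurableSet_Γ fun x hx => ?_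
    simp only [h.jump_eq hx, sq]
  have hflux : 2 * |fluxJump D 𝒯 α n v v| ≤
      1 / 2 * ∑ m, ∑ T ∈ 𝒯.triangles, α m * (volume.real (hull T ∩ D.sub m) * ‖G m T‖ ^ 2) +
      16 * L * K ^ 2 * a * H⁻¹ * J := by
    calc 2 * |fluxJump D 𝒯 α n v v|
        ≤ ∑ T ∈ 𝒯.triangles, 2 * |∫ x in D.Γ ∩ hull T, avgFlux D α T v (n x) * D.jump v x ∂μ| := by
          rw [← Finset.mul_sum]
          gcongr
          exact Finset.abs_sum_le_sum_abs _ _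
      _ ≤ ∑ T ∈ 𝒯.triangles,
          (1 / 2 * ∑ m, α m * (volume.real (hull T ∩ D.sub m) * ‖G m T‖ ^ 2) +
            4 * L * K * a * H⁻¹ * ∫ x in D.Γ ∩ hull T, (V 0 x - V 1 x) ^ 2 ∂μ) :=
          Finset.sum_le_sum fun T hT => h.two_mul_abs_flux_le hα hK0 hL0 hK hL hn hT
      _ = 1 / 2 * ∑ m, ∑ T ∈ 𝒯.triangles, α m * (volume.real (hull T ∩ D.sub m) * ‖G m T‖ ^ 2) +
            4 * L * K * a * H⁻¹ *
              ∑ T ∈ 𝒯.triangles, ∫ x in D.Γ ∩ hull T, (V 0 x - V 1 x) ^ 2 ∂μ := by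
          rw [Finset.sum_add_distrib, ← Finset.mul_sum, ← Finset.mul_sum, Finset.sum_comm]
      _ ≤ 1 / 2 * ∑ m, ∑ T ∈ 𝒯.triangles, α m * (volume.real (hull T ∩ D.sub m) * ‖G m T‖ ^ 2) +
            4 * L * K * a * H⁻¹ * (4 * K * J) := by
          gcongr
          exact sum_integral_Γ_inter_hull_le hK0.le hK h.continuousOn_jump_sq fun x => sq_nonneg _
      _ = _ := by ring
  have habs := le_abs_self (fluxJump D 𝒯 α n v v)
  have hCJ : (16 * L * K ^ 2 + 1) * (H⁻¹ * a * J) ≤ C * (H⁻¹ * a * J) := by gcongr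
  rw [nitscheForm, hjump, Finset.sum_congr rfl fun m _ => h.integral_gradient α m]
  nlinarith

lemma integral_abs_sq_sub_sq_le {K L ε : ℝ} (hL0 : 0 < L) (hε : 0 < ε)
    (hK : ∀ T ∈ 𝒯.triangles, 𝒯.meshSize ^ 2 ≤ K * volume.real (hull T))
    (hL : ∀ T ∈ 𝒯.triangles,
      (Measure.hausdorffMeasure 1 : Measure Plane).real (D.Γ ∩ hull T) ≤ L * 𝒯.meshSize)
    {T : Finset Plane} (hT : T ∈ 𝒯.triangles) :
    ∫ x in D.Γ ∩ hull T, |V 0 x ^ 2 - V 1 x ^ 2| ∂(Measure.hausdorffMeasure 1) ≤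
      (1 + (ε * 𝒯.meshSize)⁻¹) *
        (∫ x in D.Γ ∩ hull T, (V 0 x - V 1 x) ^ 2 ∂(Measure.hausdorffMeasure 1)) +
      4 * ε * L * K * ∑ m, ((∫ x in hull T ∩ D.sub m, V m x ^ 2) +
        𝒯.meshSize ^ 2 * (volume.real (hull T ∩ D.sub m) * ‖G m T‖ ^ 2)) := by
  set μ : Measure Plane := Measure.hausdorffMeasure 1 with hμ
  set H := 𝒯.meshSize with hH
  have hHpos : 0 < H := 𝒯.meshSize_pos D.isOpen_Ω D.nonempty
  have hTpos := 𝒯.volume_real_hull_pos hT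
  have hΓT : MeasurableSet (D.Γ ∩ hull T) := D.measurableSet_Γ.inter (measurableSet_hull T)
  have hint : IntegrableOn (fun x => (V 0 x - V 1 x) ^ 2) (D.Γ ∩ hull T) μ :=
    (D.integrableOn_Γ h.continuousOn_jump_sq).mono_set inter_subset_left
  have hint' : IntegrableOn (fun x => |V 0 x ^ 2 - V 1 x ^ 2|) (D.Γ ∩ hull T) μ :=
    (D.integrableOn_Γ (((h.continuousOn 0).pow 2).sub ((h.continuousOn 1).pow 2)).abs).mono_set
      inter_subset_left
  set R := ∑ m, ((∫ x in hull T ∩ D.sub m, V m x ^ 2) +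
    H ^ 2 * (volume.real (hull T ∩ D.sub m) * ‖G m T‖ ^ 2)) with hR
  have hR0 : ∀ m, 0 ≤ (∫ x in hull T ∩ D.sub m, V m x ^ 2) +
      H ^ 2 * (volume.real (hull T ∩ D.sub m) * ‖G m T‖ ^ 2) := fun m =>
    add_nonneg (integral_nonneg fun x => sq_nonneg _) (by positivity)
  obtain ⟨m, hm⟩ : ∃ m, volume.real (hull T) ≤ 2 * volume.real (hull T ∩ D.sub m) := by
    by_contra! hcon
    have h0 := hcon 0
    have h1 := hcon 1
    have := sum_volume_sub T hT
    rw [Fin.sum_univ_two] at this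
    linarith
  have hsup : ∀ x ∈ hull T, V m x ^ 2 * volume.real (hull T) ≤ 4 * R := by
    intro x hx
    have hlow : V m x ^ 2 * volume.real (hull T ∩ D.sub m) ≤
        2 * ((∫ y in hull T ∩ D.sub m, V m y ^ 2) +
          H ^ 2 * (volume.real (hull T ∩ D.sub m) * ‖G m T‖ ^ 2)) := by
      have hc : ∫ _ in hull T ∩ D.sub m, V m x ^ 2 ≤
          ∫ y in hull T ∩ D.sub m, (2 * V m y ^ 2 + 2 * (H ^ 2 * ‖G m T‖ ^ 2)) := by
        refine setIntegral_mono_on (integrableOn_const (volume_inter_ne_top _ _))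
          (((h.integrableOn_sq m hT).const_mul _).add
            (integrableOn_const (volume_inter_ne_top _ _)))
          ((measurableSet_hull T).inter (D.measurableSet_sub m)) fun y hy => ?_
        rw [h.affine m T hT y hy.1 x hx]
        have hb : |⟪G m T, x - y⟫| ≤ H * ‖G m T‖ := by
          refine (abs_real_inner_le_norm _ _).trans ?_
          rw [mul_comm]
          gcongr
          rw [← dist_eq_norm]
          exact (dist_le_hT hx hy.1).trans (𝒯.hT_le_meshSize hT)
        have hb2 : ⟪G m T, x - y⟫ ^ 2 ≤ H ^ 2 * ‖G m T‖ ^ 2 := by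
          rw [← sq_abs, ← mul_pow]
          gcongr
        nlinarith [sq_nonneg (V m y - ⟪G m T, x - y⟫)]
      rw [setIntegral_const, integral_add ((h.integrableOn_sq m hT).const_mul _)
        (integrableOn_const (volume_inter_ne_top _ _)), integral_const_mul, setIntegral_const,
        smul_eq_mul, smul_eq_mul] at hc
      linarith
    have hRm := Finset.single_le_sum (f := fun m => (∫ x in hull T ∩ D.sub m, V m x ^ 2) +
      H ^ 2 * (volume.real (hull T ∩ D.sub m) * ‖G m T‖ ^ 2)) (fun m _ => hR0 m) (Finset.mem_univ m)
    have := mul_le_mul_of_nonneg_left hm (sq_nonneg (V m x))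
    linarith
  have hpt : ∀ x ∈ D.Γ ∩ hull T, |V 0 x ^ 2 - V 1 x ^ 2| ≤
      (1 + (ε * H)⁻¹) * (V 0 x - V 1 x) ^ 2 + ε * H * (4 * R / volume.real (hull T)) := by
    intro x hx
    have h1 : |V 0 x ^ 2 - V 1 x ^ 2| ≤
        (1 + (ε * H)⁻¹) * (V 0 x - V 1 x) ^ 2 + ε * H * V m x ^ 2 := by
      have e : |V 0 x ^ 2 - V 1 x ^ 2| ≤ (V 0 x - V 1 x) ^ 2 + 2 * (|V 0 x - V 1 x| * |V m x|) := by
        have e1 : V 0 x ^ 2 - V 1 x ^ 2 = (V 0 x - V 1 x) * (V 0 x + V 1 x) := by ring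
        have e2 : |V 0 x + V 1 x| ≤ |V 0 x - V 1 x| + 2 * |V m x| := by
          fin_cases m
          · have : V 0 x + V 1 x = 2 * V 0 x - (V 0 x - V 1 x) := by ring
            rw [this]
            refine (abs_sub _ _).trans ?_
            rw [abs_mul, abs_two, add_comm]
            exact le_rfl
          · have : V 0 x + V 1 x = (V 0 x - V 1 x) + 2 * V 1 x := by ring
            rw [this]
            refine (abs_add_le _ _).trans ?_
            rw [abs_mul, abs_two]
            exact le_rfl
        rw [e1, abs_mul, ← sq_abs (V 0 x - V 1 x)]
        nlinarith [abs_nonneg (V 0 x - V 1 x)]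
      refine e.trans ?_
      rw [← sq_abs (V 0 x - V 1 x), ← sq_abs (V m x)]
      set j := |V 0 x - V 1 x|
      set w := |V m x|
      have e3 : (ε * H)⁻¹ * j ^ 2 + ε * H * w ^ 2 - 2 * (j * w) =
          (ε * H)⁻¹ * (j - ε * H * w) ^ 2 := by
        field_simp
        ring
      have : 0 ≤ (ε * H)⁻¹ * (j - ε * H * w) ^ 2 := by positivity
      linarith
    refine h1.trans ?_
    gcongr
    rw [le_div_iff₀ hTpos]
    exact hsup x hx.2
  have hconst : Integrable (fun _ => ε * H * (4 * R / volume.real (hull T)))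
      (μ.restrict (D.Γ ∩ hull T)) := integrableOn_const (hausdorffMeasure_Γ_inter_ne_top T)
  have hsq : Integrable (fun x => (1 + (ε * H)⁻¹) * (V 0 x - V 1 x) ^ 2)
      (μ.restrict (D.Γ ∩ hull T)) := hint.const_mul _
  have hg : IntegrableOn (fun x => (1 + (ε * H)⁻¹) * (V 0 x - V 1 x) ^ 2 +
    ε * H * (4 * R / volume.real (hull T))) (D.Γ ∩ hull T) μ := hsq.add hconst
  have hfinal := setIntegral_mono_on hint' hg hΓT hpt
  have hR' : 0 ≤ R := Finset.sum_nonneg fun m _ => hR0 m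
  rw [integral_add hsq hconst, integral_const_mul, setIntegral_const, smul_eq_mul] at hfinal
  refine hfinal.trans (add_le_add le_rfl ?_)
  calc μ.real (D.Γ ∩ hull T) * (ε * H * (4 * R / volume.real (hull T)))
      ≤ L * H * (ε * H * (4 * R / volume.real (hull T))) := by
        gcongr
        exact hL T hT
    _ = 4 * ε * L * R * (H ^ 2 / volume.real (hull T)) := by ring
    _ ≤ 4 * ε * L * R * K := by
        gcongr
        rw [div_le_iff₀ hTpos]
        exact hK T hT
    _ = _ := by ring

end IsSplit

/-! ### The discrete Poincaré inequality -/

namespace IsSplit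

variable {v : Plane → ℝ} {V : Fin 2 → Plane → ℝ} {G : Fin 2 → Finset Plane → Plane}
  (h : IsSplit D 𝒯 v V G)

include h

lemma ofReal_normSq : ENNReal.ofReal (D.normSq v) =
    ∑ m, ∫⁻ x in D.sub m, ENNReal.ofReal (V m x ^ 2) := by
  rw [InterfaceDomain.normSq, ENNReal.ofReal_sum_of_nonneg
    fun m _ => integral_nonneg fun x => sq_nonneg _]
  refine Finset.sum_congr rfl fun m _ => ?_
  have hint : IntegrableOn (fun x => V m x ^ 2) (D.sub m) :=
    (((h.continuousOn m).pow 2).integrableOn_compact D.isCompact_closure_Ω).mono_set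
      ((D.sub_subset m).trans subset_closure)
  rw [setIntegral_congr_fun (D.measurableSet_sub m) (g := fun x => V m x ^ 2)
    fun x hx => by simp only [h.eqOn m hx],
    ofReal_integral_eq_lintegral_ofReal hint (ae_of_all _ fun x => sq_nonneg _)]

lemma lintegral_sqGradBound_le {M : ℝ} (hM : 0 < M) : ∫⁻ x, sqGradBound D 𝒯 V G x ≤
    ENNReal.ofReal ((4 * M)⁻¹ * D.normSq v +
      4 * M * ∑ m, ∑ T ∈ 𝒯.triangles, volume.real (hull T ∩ D.sub m) * ‖G m T‖ ^ 2) := by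
  have hmeas : ∀ m, ∀ T ∈ 𝒯.triangles, Measurable ((hull T ∩ D.sub m).indicator
      fun x => ENNReal.ofReal (2 * |V m x| * ‖G m T‖)) := fun m T hT =>
    h.measurable_indicator m ((measurableSet_hull T).inter (D.measurableSet_sub m))
      (inter_subset_left.trans (𝒯.hull_subset_closure hT))
      (f := fun t => ENNReal.ofReal (2 * |t| * ‖G m T‖))
      (ENNReal.continuous_ofReal.comp (by fun_prop))
  have hterm : ∀ m, ∀ T ∈ 𝒯.triangles,
      ∫⁻ x in hull T ∩ D.sub m, ENNReal.ofReal (2 * |V m x| * ‖G m T‖) ≤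
        ENNReal.ofReal ((4 * M)⁻¹ * (∫ x in hull T ∩ D.sub m, V m x ^ 2) +
          4 * M * (volume.real (hull T ∩ D.sub m) * ‖G m T‖ ^ 2)) := by
    intro m T hT
    have hsq : Integrable (fun x => (4 * M)⁻¹ * V m x ^ 2) (volume.restrict (hull T ∩ D.sub m)) :=
      (h.integrableOn_sq m hT).const_mul _
    have hconst : Integrable (fun _ => 4 * M * ‖G m T‖ ^ 2)
        (volume.restrict (hull T ∩ D.sub m)) := integrableOn_const (volume_inter_ne_top _ _)
    have hg : Integrable (fun x => (4 * M)⁻¹ * V m x ^ 2 + 4 * M * ‖G m T‖ ^ 2)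
        (volume.restrict (hull T ∩ D.sub m)) := hsq.add hconst
    have hval : ∫ x in hull T ∩ D.sub m, ((4 * M)⁻¹ * V m x ^ 2 + 4 * M * ‖G m T‖ ^ 2) =
        (4 * M)⁻¹ * (∫ x in hull T ∩ D.sub m, V m x ^ 2) +
          4 * M * (volume.real (hull T ∩ D.sub m) * ‖G m T‖ ^ 2) := by
      rw [integral_add hsq hconst, integral_const_mul, setIntegral_const, smul_eq_mul]
      ring
    rw [← hval, ofReal_integral_eq_lintegral_ofReal hg (ae_of_all _ fun x => by positivity)]
    refine lintegral_mono fun x => ENNReal.ofReal_le_ofReal ?_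
    rw [← sq_abs (V m x)]
    have e : (4 * M)⁻¹ * |V m x| ^ 2 + 4 * M * ‖G m T‖ ^ 2 - 2 * |V m x| * ‖G m T‖ =
        (4 * M)⁻¹ * (|V m x| - 4 * M * ‖G m T‖) ^ 2 := by
      field_simp
      ring
    have : 0 ≤ (4 * M)⁻¹ * (|V m x| - 4 * M * ‖G m T‖) ^ 2 := by positivity
    linarith
  have hnonneg : ∀ m, ∀ T ∈ 𝒯.triangles, 0 ≤ (4 * M)⁻¹ * (∫ x in hull T ∩ D.sub m, V m x ^ 2) +
      4 * M * (volume.real (hull T ∩ D.sub m) * ‖G m T‖ ^ 2) := fun m T _ =>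
    add_nonneg (mul_nonneg (by positivity) (integral_nonneg fun x => sq_nonneg _)) (by positivity)
  calc ∫⁻ x, sqGradBound D 𝒯 V G x
      = ∑ m, ∑ T ∈ 𝒯.triangles,
          ∫⁻ x in hull T ∩ D.sub m, ENNReal.ofReal (2 * |V m x| * ‖G m T‖) := by
        unfold sqGradBound
        rw [lintegral_finsetSum _ fun m _ => Finset.measurable_fun_sum _ (hmeas m)]
        refine Finset.sum_congr rfl fun m _ => ?_
        rw [lintegral_finsetSum _ (hmeas m)]
        exact Finset.sum_congr rfl fun T _ =>
          lintegral_indicator ((measurableSet_hull T).inter (D.measurableSet_sub m)) _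
    _ ≤ ∑ m, ∑ T ∈ 𝒯.triangles,
          ENNReal.ofReal ((4 * M)⁻¹ * (∫ x in hull T ∩ D.sub m, V m x ^ 2) +
            4 * M * (volume.real (hull T ∩ D.sub m) * ‖G m T‖ ^ 2)) :=
        Finset.sum_le_sum fun m _ => Finset.sum_le_sum (hterm m)
    _ = _ := by
        rw [h.normSq_eq, Finset.mul_sum, Finset.mul_sum, ← Finset.sum_add_distrib,
          ENNReal.ofReal_sum_of_nonneg fun m _ => ?_]
        · refine Finset.sum_congr rfl fun m _ => ?_
          rw [Finset.mul_sum, Finset.mul_sum, ← Finset.sum_add_distrib,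
            ENNReal.ofReal_sum_of_nonneg (hnonneg m)]
        · rw [Finset.mul_sum, Finset.mul_sum, ← Finset.sum_add_distrib]
          exact Finset.sum_nonneg (hnonneg m)

lemma lintegral_jump_sq_le {K L ε : ℝ} (hK0 : 0 < K) (hL0 : 0 < L) (hε : 0 < ε)
    (hK : ∀ T ∈ 𝒯.triangles, 𝒯.meshSize ^ 2 ≤ K * volume.real (hull T))
    (hL : ∀ T ∈ 𝒯.triangles,
      (Measure.hausdorffMeasure 1 : Measure Plane).real (D.Γ ∩ hull T) ≤ L * 𝒯.meshSize) :
    ∫⁻ x in D.Γ, ENNReal.ofReal |V 0 x ^ 2 - V 1 x ^ 2| ∂(Measure.hausdorffMeasure 1) ≤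
      ENNReal.ofReal ((1 + (ε * 𝒯.meshSize)⁻¹) * (4 * K *
        ∫ x in D.Γ, (V 0 x - V 1 x) ^ 2 ∂(Measure.hausdorffMeasure 1)) +
      4 * ε * L * K * (D.normSq v + 𝒯.meshSize ^ 2 *
        ∑ m, ∑ T ∈ 𝒯.triangles, volume.real (hull T ∩ D.sub m) * ‖G m T‖ ^ 2)) := by
  set μ : Measure Plane := Measure.hausdorffMeasure 1 with hμ
  have hHpos : 0 < 𝒯.meshSize := 𝒯.meshSize_pos D.isOpen_Ω D.nonempty
  have hcont : ContinuousOn (fun x => |V 0 x ^ 2 - V 1 x ^ 2|) (closure D.Ω) :=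
    (((h.continuousOn 0).pow 2).sub ((h.continuousOn 1).pow 2)).abs
  have hcov : D.Γ ⊆ ⋃ T : 𝒯.triangles, D.Γ ∩ hull T.1 := by
    intro x hx
    have := 𝒯.closure_subset_iUnion_hull D.isOpen_Ω (subset_closure hx.1)
    simp only [mem_iUnion] at this ⊢
    obtain ⟨T, hT, hxT⟩ := this
    exact ⟨⟨T, hT⟩, hx, hxT⟩
  calc ∫⁻ x in D.Γ, ENNReal.ofReal |V 0 x ^ 2 - V 1 x ^ 2| ∂μ
      ≤ ∫⁻ x in ⋃ T : 𝒯.triangles, D.Γ ∩ hull T.1, ENNReal.ofReal |V 0 x ^ 2 - V 1 x ^ 2| ∂μ :=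
        lintegral_mono_set hcov
    _ ≤ ∑ T ∈ 𝒯.triangles, ∫⁻ x in D.Γ ∩ hull T, ENNReal.ofReal |V 0 x ^ 2 - V 1 x ^ 2| ∂μ := by
        refine (lintegral_iUnion_le _ _).trans (le_of_eq ?_)
        rw [tsum_fintype]
        exact Finset.sum_coe_sort 𝒯.triangles
          fun T => ∫⁻ x in D.Γ ∩ hull T, ENNReal.ofReal |V 0 x ^ 2 - V 1 x ^ 2| ∂μ
    _ = ENNReal.ofReal (∑ T ∈ 𝒯.triangles, ∫ x in D.Γ ∩ hull T, |V 0 x ^ 2 - V 1 x ^ 2| ∂μ) := by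
        rw [ENNReal.ofReal_sum_of_nonneg fun T _ => integral_nonneg fun x => abs_nonneg _]
        refine Finset.sum_congr rfl fun T _ => ?_
        rw [ofReal_integral_eq_lintegral_ofReal
          ((D.integrableOn_Γ hcont).mono_set inter_subset_left) (ae_of_all _ fun x => abs_nonneg _)]
    _ ≤ _ := by
        refine ENNReal.ofReal_le_ofReal ?_
        refine (Finset.sum_le_sum fun T hT => h.integral_abs_sq_sub_sq_le hL0 hε hK hL hT).trans ?_
        rw [Finset.sum_add_distrib, ← Finset.mul_sum, ← Finset.mul_sum (s := 𝒯.triangles),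
          Finset.sum_comm]
        refine add_le_add ?_ (le_of_eq ?_)
        · gcongr
          exact sum_integral_Γ_inter_hull_le hK0.le hK h.continuousOn_jump_sq fun x => sq_nonneg _
        · rw [h.normSq_eq]
          simp only [Finset.mul_sum, Finset.sum_add_distrib]

/-- A Poincaré inequality for the broken energy norm. -/
lemma normSq_le {K L M : ℝ} (hK0 : 0 < K) (hL0 : 0 < L) (hM : 0 < M)
    (hdiam : Metric.diam D.Ω ≤ M)
    (hK : ∀ T ∈ 𝒯.triangles, 𝒯.meshSize ^ 2 ≤ K * volume.real (hull T))
    (hL : ∀ T ∈ 𝒯.triangles,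
      (Measure.hausdorffMeasure 1 : Measure Plane).real (D.Γ ∩ hull T) ≤ L * 𝒯.meshSize) :
    D.normSq v ≤
      10 * M ^ 2 * (∑ m, ∑ T ∈ 𝒯.triangles, volume.real (hull T ∩ D.sub m) * ‖G m T‖ ^ 2) +
      8 * K * M ^ 2 * (1 + 16 * L * K) * (𝒯.meshSize⁻¹ *
        ∫ x in D.Γ, (V 0 x - V 1 x) ^ 2 ∂(Measure.hausdorffMeasure 1)) := by
  set H := 𝒯.meshSize with hH
  have hHpos : 0 < H := 𝒯.meshSize_pos D.isOpen_Ω D.nonempty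
  have hHM : H ≤ M := (𝒯.meshSize_le_diam D.isOpen_Ω D.nonempty D.isBounded_Ω).trans hdiam
  set E := ∑ m, ∑ T ∈ 𝒯.triangles, volume.real (hull T ∩ D.sub m) * ‖G m T‖ ^ 2 with hE
  set J := ∫ x in D.Γ, (V 0 x - V 1 x) ^ 2 ∂(Measure.hausdorffMeasure 1) with hJ
  set N := D.normSq v with hN
  have hE0 : 0 ≤ E := Finset.sum_nonneg fun m _ => Finset.sum_nonneg fun T _ => by positivity
  have hJ0 : 0 ≤ J := integral_nonneg fun x => sq_nonneg _
  have hN0 : 0 ≤ N := Finset.sum_nonneg fun m _ => integral_nonneg fun x => sq_nonneg _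
  set ε := (16 * M * L * K)⁻¹ with hε
  have hεpos : 0 < ε := by positivity
  have hmain : ENNReal.ofReal N ≤ ENNReal.ofReal (M * (((4 * M)⁻¹ * N + 4 * M * E) +
      ((1 + (ε * H)⁻¹) * (4 * K * J) + 4 * ε * L * K * (N + H ^ 2 * E)))) := by
    rw [ENNReal.ofReal_mul hM.le, ENNReal.ofReal_add (by positivity) (by positivity),
      h.ofReal_normSq]
    refine h.lintegral_sq_le.trans ?_
    gcongr
    · exact h.lintegral_sqGradBound_le hM
    · exact h.lintegral_jump_sq_le hK0 hL0 hεpos hK hL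
  rw [ENNReal.ofReal_le_ofReal_iff (by positivity)] at hmain
  have e1 : M * (((4 * M)⁻¹ * N + 4 * M * E) +
      ((1 + (ε * H)⁻¹) * (4 * K * J) + 4 * ε * L * K * (N + H ^ 2 * E))) =
      N / 2 + (4 * M ^ 2 + H ^ 2 / 4) * E +
        4 * K * M * (H + 16 * M * L * K) * (H⁻¹ * J) := by
    rw [hε]
    field_simp
    ring
  rw [e1] at hmain
  have e2 : H ^ 2 ≤ M ^ 2 := by gcongr
  have e3 : 4 * K * M * (H + 16 * M * L * K) * (H⁻¹ * J) ≤
      4 * K * M * (M + 16 * M * L * K) * (H⁻¹ * J) := by gcongr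
  have e4 : (4 * M ^ 2 + H ^ 2 / 4) * E ≤ 5 * M ^ 2 * E := by
    gcongr
    nlinarith [sq_nonneg M]
  linarith

end IsSplit

lemma norm_le_one_of_isUnitNormalInto {m : Fin 2} {n : Plane → Plane}
    (hn : D.IsUnitNormalInto m n) {x : Plane} (hx : x ∈ D.Γ) : ‖n x‖ ≤ 1 := by
  obtain ⟨U, φ, -, -, -, -, -, h⟩ := hn x hx
  rw [h, norm_smul, norm_inv, norm_norm]
  exact inv_mul_le_one

end NitscheXFEM
end

open NitscheXFEM in
theorem theorem3p1 (D : InterfaceDomain) (α : Fin 2 → ℝ) (hα : ∀ m, 0 < α m) (σ τ : ℝ) :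
    ∃ C₀ > 0, ∃ c > 0, ∀ C ≥ C₀, ∀ 𝒯 : Triangulation D.Ω,
      𝒯.ShapeRegular σ → 𝒯.QuasiUniform τ → TwoPointCuts D 𝒯 → GraphCuts D 𝒯 →
      ∀ (m : Fin 2) (n : Plane → Plane), D.IsUnitNormalInto m n →
      ∀ v ∈ xfemSpace D 𝒯, c * D.normSq v ≤ nitscheForm D 𝒯 α C n v v := by
  obtain ⟨L, hL0, hL⟩ := D.exists_length_le
  set K : ℝ := 16 * σ ^ 2 * τ ^ 2 + 1 with hKdef
  have hK0 : 0 < K := by positivity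
  set M : ℝ := Metric.diam D.Ω + 1 with hMdef
  have hM : 0 < M := add_pos_of_nonneg_of_pos Metric.diam_nonneg one_pos
  set a : ℝ := min (α 0) (α 1) with ha
  have ha0 : 0 < a := lt_min (hα 0) (hα 1)
  set P : ℝ := 20 * M ^ 2 + 8 * K * M ^ 2 * (1 + 16 * L * K) with hP
  have hP0 : 0 < P := by positivity
  refine ⟨16 * L * K ^ 2 + 1, by positivity, a / P, by positivity, ?_⟩
  intro C hC 𝒯 hσ hτ _ _ m n hn v hv
  obtain ⟨V, G, h⟩ := exists_isSplit hv
  have hKT : ∀ T ∈ 𝒯.triangles, 𝒯.meshSize ^ 2 ≤ K * MeasureTheory.volume.real (hull T) :=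
    fun T hT => 𝒯.meshSize_sq_le D.isOpen_Ω D.nonempty hσ hτ hT
  have hLT : ∀ T ∈ 𝒯.triangles, (MeasureTheory.Measure.hausdorffMeasure 1 :
      MeasureTheory.Measure Plane).real (D.Γ ∩ hull T) ≤ L * 𝒯.meshSize :=
    fun T hT => hausdorffMeasure_Γ_inter_hull_le hL0 hL hT
  have hHpos : 0 < 𝒯.meshSize := 𝒯.meshSize_pos D.isOpen_Ω D.nonempty
  have h1 := h.energy_le_nitscheForm hα hK0 hL0 hKT hLT
    (fun x hx => norm_le_one_of_isUnitNormalInto hn hx) hC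
  have h2 := h.normSq_le hK0 hL0 hM (by linarith) hKT hLT
  set E := ∑ m, ∑ T ∈ 𝒯.triangles, MeasureTheory.volume.real (hull T ∩ D.sub m) * ‖G m T‖ ^ 2
    with hE
  set J := 𝒯.meshSize⁻¹ *
    ∫ x in D.Γ, (V 0 x - V 1 x) ^ 2 ∂(MeasureTheory.Measure.hausdorffMeasure 1) with hJ
  have hE0 : 0 ≤ E := Finset.sum_nonneg fun m _ => Finset.sum_nonneg fun T _ => by positivity
  have hJ0 : 0 ≤ J :=
    mul_nonneg (by positivity) (MeasureTheory.integral_nonneg fun x => sq_nonneg _)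
  have hEα : a * E ≤ ∑ m, ∑ T ∈ 𝒯.triangles,
      α m * (MeasureTheory.volume.real (hull T ∩ D.sub m) * ‖G m T‖ ^ 2) := by
    rw [hE, Finset.mul_sum]
    refine Finset.sum_le_sum fun m _ => ?_
    rw [Finset.mul_sum]
    refine Finset.sum_le_sum fun T _ => mul_le_mul_of_nonneg_right ?_ (by positivity)
    fin_cases m
    exacts [min_le_left _ _, min_le_right _ _]
  have hJα : a * J ≤ max (α 0) (α 1) * J := by
    gcongr
    exact min_le_max
  rw [mul_assoc, ← hJ] at h1
  have h3 : a / P * D.normSq v ≤ 1 / 2 * (a * E) + a * J := by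
    rw [div_mul_eq_mul_div, div_le_iff₀ hP0]
    have h4 : D.normSq v ≤ (1 / 2 * E + J) * P := by
      have : 0 ≤ 4 * K * M ^ 2 * (1 + 16 * L * K) * E + 20 * M ^ 2 * J := by positivity
      rw [hP]
      linarith
    calc a * D.normSq v ≤ a * ((1 / 2 * E + J) * P) := by gcongr
      _ = _ := by ring
  linarith
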